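/- Let $\mathcal W$ be the class of all measurable (not necessarily symmetric) functions $W:\mathcal S\times\mathcal S\to[0,1]$, where $(\mathcal S,\mathcal F,\mu)$ is an arbitrary probability space (taken in a fixed universe of sets) and $\mathcal S\times\mathcal S$ carries the product $\sigma$-field. For a bounded measurable $U:\mathcal S\times\mathcal S\to\mathbb R$ put $$\|U\|_{\square}=\sup_{S,T}\Bigl|\int_{S\times T}U(x,y)\,d\mu(x)\,d\mu(y)\Bigr|,$$ the supremum being over all measurable $S,T\subseteq\mathcal S$. For $W_1,W_2\in\mathcal W$, defined on $(\mathcal S_1,\mu_1)$ and $(\mathcal S_2,\mu_2)$, put $$\delta_{\square}(W_1,W_2)=\inf_{\varphi_1,\varphi_2}\bigl\|W_1^{\varphi_1}-W_2^{\varphi_2}\bigr\|_{\square},\qquad W^{\varphi}(x,y)=W(\varphi(x),\varphi(y)),$$ the infimum being over all pairs of measure preserving maps $\varphi_1:\mathcal S\to\mathcal S_1$, $\varphi_2:\mathcal S\to\mathcal S_2$ defined on a common probability space $(\mathcal S,\mu)$. A function $W\in\mathcal W$ on $(\mathcal S,\mathcal F,\mu)$ is a poset kernel if there is a (strict) partial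 order $\prec$ on $\mathcal S$ such that $\{(x,y):x\prec y\}$ belongs to the product $\sigma$-field and, for all $x,y,z\in\mathcal S$, $W(x,y)>0$ implies $x\prec y$, and $W(x,y)>0$ and $W(y,z)>0$ imply $W(x,z)=1$. Then $W_1\cong W_2\iff\delta_{\square}(W_1,W_2)=0$ is an equivalence relation on $\mathcal W$, $\delta_\square$ is well defined on the quotient $\overline{\mathcal W}=\mathcal W/{\cong}$, and $(\overline{\mathcal W},\delta_\square)$ is a compact metric space. The subset $\overline{\mathcal W}_{\mathsf P}\subseteq\overline{\mathcal W}$ of all classes of poset kernels is closed in $\overline{\mathcal W}$; hence $(\overline{\mathcal W}_{\mathsf P},\delta_\square)$ is a compact metric space. -/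

import Mathlib

open MeasureTheory Set

universe u

/-- The cut norm of a (bounded measurable) real function `W` on the square of a probability space:
the supremum of `|∫_{S × T} W d(μ × μ)|` over all measurable sets `S`, `T`. -/
noncomputable def cutNorm {Ω : Type u} [MeasurableSpace Ω] (μ : Measure Ω) (W : Ω × Ω → ℝ) : ℝ :=
  sSup {c : ℝ | ∃ S T : Set Ω, MeasurableSet S ∧ MeasurableSet T ∧
    c = |∫ p in S ×ˢ T, W p ∂(μ.prod μ)|}

/-- A not necessarily symmetric measurable `[0,1]`-valued function on the square of an arbitrary
probability space (no regularity of the space is assumed); the square carries the product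
`σ`-field. -/
structure CutFunction : Type (u + 1) where
  /-- the underlying set of the probability space -/
  carrier : Type u
  [measurableSpace : MeasurableSpace carrier]
  /-- the probability measure -/
  μ : Measure carrier
  [isProbabilityMeasure : IsProbabilityMeasure μ]
  /-- the function on the square -/
  W : carrier × carrier → ℝ
  measurable_W : Measurable W
  W_mem : ∀ p, W p ∈ Icc (0 : ℝ) 1

attribute [instance] CutFunction.measurableSpace CutFunction.isProbabilityMeasure

namespace CutFunction

/-- The cut metric: the infimum of `‖W₁^{φ₁} - W₂^{φ₂}‖_cut` over all pairs of measure preserving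
maps `φ₁`, `φ₂` from a common probability space to the two given ones, where
`W^φ (x, y) = W (φ x, φ y)`. -/
noncomputable def cutDist (K₁ K₂ : CutFunction.{u}) : ℝ :=
  sInf {d : ℝ | ∃ (Ω : Type u) (_ : MeasurableSpace Ω) (μ : Measure Ω) (_ : IsProbabilityMeasure μ)
    (φ₁ : Ω → K₁.carrier) (φ₂ : Ω → K₂.carrier),
    MeasurePreserving φ₁ μ K₁.μ ∧ MeasurePreserving φ₂ μ K₂.μ ∧
    d = cutNorm μ (fun p => K₁.W (φ₁ p.1, φ₁ p.2) - K₂.W (φ₂ p.1, φ₂ p.2))}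

/-- Cut-equivalence. -/
def CutEquiv (K₁ K₂ : CutFunction.{u}) : Prop := cutDist K₁ K₂ = 0

/-- `K` is a poset kernel: there is a (strict) partial order `≺` on the underlying probability
space, with measurable graph `{(x, y) : x ≺ y}`, such that `W (x, y) > 0` implies `x ≺ y`, and
`W (x, y) > 0` and `W (y, z) > 0` together imply `W (x, z) = 1`, for all points `x`, `y`, `z`. -/
def IsPosetKernel (K : CutFunction.{u}) : Prop :=
  ∃ r : K.carrier → K.carrier → Prop, IsStrictOrder K.carrier r ∧
    MeasurableSet {p : K.carrier × K.carrier | r p.1 p.2} ∧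
    (∀ x y, 0 < K.W (x, y) → r x y) ∧
    (∀ x y z, 0 < K.W (x, y) → 0 < K.W (y, z) → K.W (x, z) = 1)

end CutFunction

/-- The quotient of the class of all `[0,1]`-valued functions modulo cut-equivalence. -/
def CutSpace : Type (u + 1) := Quot CutFunction.CutEquiv.{u}

namespace CutSpace

/-- The class of a function modulo cut-equivalence. -/
def mk (K : CutFunction.{u}) : CutSpace.{u} := Quot.mk _ K

/-- The set of the classes that contain a poset kernel. -/
def posetKernels : Set CutSpace.{u} := mk '' {K | K.IsPosetKernel}

end CutSpace

/-! ### The cut norm, weighted test functions and pullbacks. -/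

section CutNorm

variable {Ω : Type*} [MeasurableSpace Ω] {μ : Measure Ω}

theorem abs_setIntegral_le_integral_abs {V : Ω → ℝ} (hV : Integrable V μ) (A : Set Ω) :
    |∫ p in A, V p ∂μ| ≤ ∫ p, |V p| ∂μ :=
  (abs_integral_le_integral_abs).trans
    (setIntegral_le_integral hV.abs (Filter.Eventually.of_forall fun _ => abs_nonneg _))

/-- If the integrals of `h` over all measurable sets are at most `c` in absolute value, so are
the integrals of `h` against `[0,1]`-valued weights. -/
theorem abs_integral_mul_le_of_setIntegral {h f : Ω → ℝ} {c : ℝ} (hh : Integrable h μ)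
    (hc : ∀ S, MeasurableSet S → |∫ x in S, h x ∂μ| ≤ c)
    (hf : Measurable f) (hf01 : ∀ x, f x ∈ Icc (0 : ℝ) 1) :
    |∫ x, f x * h x ∂μ| ≤ c := by
  -- Among `[0,1]`-valued weights, the indicator of `{k ≥ 0}` maximizes the integral; both signs
  -- follow by applying this to `h` and `-h`.
  have key : ∀ k : Ω → ℝ, Integrable k μ → (∀ S, MeasurableSet S → |∫ x in S, k x ∂μ| ≤ c) →
      ∫ x, f x * k x ∂μ ≤ c := by
    intro k hk hkc
    obtain ⟨k', hk'm, hkk'⟩ := hk.aestronglyMeasurable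
    have hk' : Integrable k' μ := hk.congr hkk'
    have hS : MeasurableSet {x | 0 ≤ k' x} := measurableSet_le measurable_const hk'm.measurable
    calc ∫ x, f x * k x ∂μ = ∫ x, f x * k' x ∂μ :=
          integral_congr_ae (hkk'.mono fun x hx => by simp only [hx])
      _ ≤ ∫ x, {x | 0 ≤ k' x}.indicator k' x ∂μ := by
          refine integral_mono ?_ (hk'.indicator hS) fun x => ?_
          · exact hk'.bdd_mul (c := 1) hf.aestronglyMeasurable
              (Filter.Eventually.of_forall fun x => by
                rw [Real.norm_eq_abs, abs_of_nonneg (hf01 x).1]; exact (hf01 x).2)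
          · by_cases hx : 0 ≤ k' x
            · simp only [mem_ofPred_eq, hx, indicator_of_mem]
              nlinarith [(hf01 x).2]
            · simp only [mem_ofPred_eq, hx, not_false_eq_true, indicator_of_notMem]
              nlinarith [(hf01 x).1]
      _ = ∫ x in {x | 0 ≤ k' x}, k x ∂μ := by
          rw [integral_indicator hS]
          exact integral_congr_ae (ae_restrict_of_ae (hkk'.mono fun x hx => hx.symm))
      _ ≤ c := (le_abs_self _).trans (hkc _ hS)
  refine abs_le.2 ⟨?_, key h hh hc⟩
  have := key (fun x => - h x) hh.neg fun S hS => by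
    rw [integral_neg, abs_neg]; exact hc S hS
  simp only [mul_neg, integral_neg] at this
  linarith

end CutNorm

section CutNorm

variable {Ω : Type u} [MeasurableSpace Ω] {μ : Measure Ω}

theorem cutNorm_le {W : Ω × Ω → ℝ} {c : ℝ}
    (h : ∀ S T, MeasurableSet S → MeasurableSet T → |∫ p in S ×ˢ T, W p ∂(μ.prod μ)| ≤ c) :
    cutNorm μ W ≤ c := by
  refine csSup_le ⟨_, ∅, ∅, .empty, .empty, rfl⟩ ?_
  rintro _ ⟨S, T, hS, hT, rfl⟩
  exact h S T hS hT

theorem abs_setIntegral_le_cutNorm {W : Ω × Ω → ℝ} (hW : Integrable W (μ.prod μ)) {S T : Set Ω}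
    (hS : MeasurableSet S) (hT : MeasurableSet T) :
    |∫ p in S ×ˢ T, W p ∂(μ.prod μ)| ≤ cutNorm μ W := by
  refine le_csSup ⟨∫ p, |W p| ∂(μ.prod μ), ?_⟩ ⟨S, T, hS, hT, rfl⟩
  rintro _ ⟨S, T, -, -, rfl⟩
  exact abs_setIntegral_le_integral_abs hW _

theorem cutNorm_nonneg (W : Ω × Ω → ℝ) : 0 ≤ cutNorm μ W := by
  refine Real.sSup_nonneg ?_
  rintro _ ⟨S, T, -, -, rfl⟩
  exact abs_nonneg _

theorem cutNorm_le_integral_abs {W : Ω × Ω → ℝ} (hW : Integrable W (μ.prod μ)) :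
    cutNorm μ W ≤ ∫ p, |W p| ∂(μ.prod μ) :=
  cutNorm_le fun _ _ _ _ => abs_setIntegral_le_integral_abs hW _

theorem cutNorm_congr_ae {V W : Ω × Ω → ℝ} (h : V =ᵐ[μ.prod μ] W) : cutNorm μ V = cutNorm μ W := by
  unfold cutNorm
  congr 1
  ext c
  refine exists₂_congr fun S T => and_congr_right fun _ => and_congr_right fun _ => ?_
  rw [integral_congr_ae (ae_restrict_of_ae h)]

theorem cutNorm_add_le {V W : Ω × Ω → ℝ} (hV : Integrable V (μ.prod μ))
    (hW : Integrable W (μ.prod μ)) :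
    cutNorm μ (fun p => V p + W p) ≤ cutNorm μ V + cutNorm μ W := by
  refine cutNorm_le fun S T hS hT => ?_
  rw [integral_add hV.integrableOn hW.integrableOn]
  exact (abs_add_le _ _).trans (add_le_add (abs_setIntegral_le_cutNorm hV hS hT)
    (abs_setIntegral_le_cutNorm hW hS hT))

theorem cutNorm_neg (W : Ω × Ω → ℝ) : cutNorm μ (fun p => - W p) = cutNorm μ W := by
  simp only [cutNorm, integral_neg, abs_neg]

theorem cutNorm_sub_comm (V W : Ω × Ω → ℝ) :
    cutNorm μ (fun p => V p - W p) = cutNorm μ (fun p => W p - V p) := by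
  rw [← cutNorm_neg]
  simp only [neg_sub]

theorem cutNorm_sub_le {U V W : Ω × Ω → ℝ} (hU : Integrable U (μ.prod μ))
    (hV : Integrable V (μ.prod μ)) (hW : Integrable W (μ.prod μ)) :
    cutNorm μ (fun p => U p - W p) ≤
      cutNorm μ (fun p => U p - V p) + cutNorm μ (fun p => V p - W p) := by
  have := cutNorm_add_le (hU.sub hV) (hV.sub hW)
  simp only [Pi.sub_apply, sub_add_sub_cancel] at this
  exact this

/-- The easy half of invariance under pullback: test rectangles pull back to test rectangles. -/
theorem cutNorm_le_comp {Ω' : Type*} [MeasurableSpace Ω'] {μ' : Measure Ω'}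
    [IsProbabilityMeasure μ'] {φ : Ω' → Ω} (hφ : MeasurePreserving φ μ' μ) {W : Ω × Ω → ℝ}
    (hW : Measurable W) (hWi : Integrable W (μ.prod μ)) :
    cutNorm μ W ≤ cutNorm μ' (fun p => W (φ p.1, φ p.2)) := by
  have hφφ : MeasurePreserving (Prod.map φ φ) (μ'.prod μ') (μ.prod μ) := hφ.prod hφ
  refine cutNorm_le fun S T hS hT => ?_
  have : ∫ p in S ×ˢ T, W p ∂(μ.prod μ)
      = ∫ p in (φ ⁻¹' S) ×ˢ (φ ⁻¹' T), W (φ p.1, φ p.2) ∂(μ'.prod μ') := by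
    rw [← hφφ.map_eq, setIntegral_map (hS.prod hT) hW.aestronglyMeasurable
      hφφ.measurable.aemeasurable]
    rfl
  rw [this]
  exact abs_setIntegral_le_cutNorm (hφφ.integrable_comp_of_integrable hWi)
    (hφ.measurable hS) (hφ.measurable hT)

variable [IsProbabilityMeasure μ]

theorem cutNorm_swap (W : Ω × Ω → ℝ) : cutNorm μ (fun p => W p.swap) = cutNorm μ W := by
  have key : ∀ S T, ∫ p in S ×ˢ T, W p.swap ∂(μ.prod μ) = ∫ p in T ×ˢ S, W p ∂(μ.prod μ) := by
    intro S T
    have h := (Measure.measurePreserving_swap (μ := μ) (ν := μ)).setIntegral_preimage_emb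
      MeasurableEquiv.prodComm.measurableEmbedding W (T ×ˢ S)
    rwa [preimage_swap_prod] at h
  unfold cutNorm
  congr 1
  ext c
  constructor
  · rintro ⟨S, T, hS, hT, rfl⟩
    exact ⟨T, S, hT, hS, by rw [key]⟩
  · rintro ⟨S, T, hS, hT, rfl⟩
    exact ⟨T, S, hT, hS, by rw [key]⟩

/-- The integral is bilinear in the two weights, so sets are extremal:
`abs_integral_mul_le_of_setIntegral` is applied in one variable with a set `T` in the other, and
then in the other variable. -/
theorem abs_integral_mul_mul_le_cutNorm {W : Ω × Ω → ℝ} (hW : Integrable W (μ.prod μ))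
    {f g : Ω → ℝ} (hf : Measurable f) (hf01 : ∀ x, f x ∈ Icc (0 : ℝ) 1)
    (hg : Measurable g) (hg01 : ∀ x, g x ∈ Icc (0 : ℝ) 1) :
    |∫ p, f p.1 * g p.2 * W p ∂(μ.prod μ)| ≤ cutNorm μ W := by
  have bdd : ∀ {f : Ω → ℝ}, (∀ x, f x ∈ Icc (0 : ℝ) 1) → ∀ x, ‖f x‖ ≤ 1 := fun h x => by
    rw [Real.norm_eq_abs, abs_of_nonneg (h x).1]; exact (h x).2
  have hWf : Integrable (fun p : Ω × Ω => f p.1 * W p) (μ.prod μ) :=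
    hW.bdd_mul (c := 1) (hf.comp measurable_fst).aestronglyMeasurable
      (Filter.Eventually.of_forall fun p => bdd hf01 p.1)
  have hWfg : Integrable (fun p : Ω × Ω => f p.1 * g p.2 * W p) (μ.prod μ) := by
    have := hWf.bdd_mul (c := 1) (f := fun p : Ω × Ω => g p.2)
      (hg.comp measurable_snd).aestronglyMeasurable
      (Filter.Eventually.of_forall fun p => bdd hg01 p.2)
    refine this.congr (Filter.Eventually.of_forall fun p => ?_)
    simp only
    ring
  have step : ∀ T, MeasurableSet T →
      |∫ p in univ ×ˢ T, f p.1 * W p ∂(μ.prod μ)| ≤ cutNorm μ W := by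
    intro T hT
    have hWT : Integrable W (μ.prod (μ.restrict T)) := by
      have := hW.restrict (s := univ ×ˢ T)
      rwa [← Measure.prod_restrict, Measure.restrict_univ] at this
    have e1 : ∫ p in univ ×ˢ T, f p.1 * W p ∂(μ.prod μ)
        = ∫ x, f x * ∫ y in T, W (x, y) ∂μ ∂μ := by
      rw [← Measure.prod_restrict, Measure.restrict_univ, integral_prod]
      · simp only [integral_const_mul]
      · have := hWf.restrict (s := univ ×ˢ T)
        rwa [← Measure.prod_restrict, Measure.restrict_univ] at this
    rw [e1]
    refine abs_integral_mul_le_of_setIntegral hWT.integral_prod_left (fun S hS => ?_) hf hf01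
    rw [← setIntegral_prod (f := W)]
    · exact abs_setIntegral_le_cutNorm hW hS hT
    · exact hW.integrableOn
  rw [integral_prod_symm _ hWfg]
  have e2 : ∀ y, ∫ x, f x * g y * W (x, y) ∂μ = g y * ∫ x, f x * W (x, y) ∂μ := by
    intro y
    rw [← integral_const_mul]
    congr 1
    ext x
    ring
  simp only [e2]
  refine abs_integral_mul_le_of_setIntegral hWf.integral_prod_right (fun T hT => ?_) hg hg01
  have := step T hT
  rw [← Measure.prod_restrict, Measure.restrict_univ, integral_prod_symm] at this
  · exact this
  · have := hWf.restrict (s := univ ×ˢ T)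
    rwa [← Measure.prod_restrict, Measure.restrict_univ] at this

/-- The Radon–Nikodym derivative is at most 1 almost everywhere; the minimum with 1 makes this hold
everywhere. -/
theorem MeasureTheory.Measure.exists_eq_withDensity_of_le {ν : Measure Ω} (h : ν ≤ μ) :
    ∃ f : Ω → ℝ, Measurable f ∧ (∀ x, f x ∈ Icc (0 : ℝ) 1) ∧
      ν = μ.withDensity fun x => ENNReal.ofReal (f x) := by
  have : IsFiniteMeasure ν := isFiniteMeasure_of_le μ h
  refine ⟨fun x => (min (ν.rnDeriv μ x) 1).toReal,
    ((ν.measurable_rnDeriv μ).min measurable_const).ennreal_toReal,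
    fun x => ⟨ENNReal.toReal_nonneg, ?_⟩, ?_⟩
  · exact ENNReal.toReal_le_of_le_ofReal zero_le_one (by simp)
  · conv_lhs => rw [← Measure.withDensity_rnDeriv_eq ν μ (Measure.absolutelyContinuous_of_le h)]
    refine withDensity_congr_ae ?_
    filter_upwards [Measure.rnDeriv_le_one_of_le h] with x hx
    rw [Pi.one_apply] at hx
    rw [ENNReal.ofReal_toReal (by simp), min_eq_left hx]

/-- Test sets upstairs need not be preimages. Pushing forward `μ'` restricted to `S` gives a measure
below `μ`, whose density plays the role of the conditional expectation of the indicator of `S`.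
Rectangles thus become `[0,1]`-valued weights, which the cut norm also controls. -/
theorem cutNorm_comp_le {Ω' : Type*} [MeasurableSpace Ω'] {μ' : Measure Ω'}
    [IsProbabilityMeasure μ'] {φ : Ω' → Ω} (hφ : MeasurePreserving φ μ' μ) {W : Ω × Ω → ℝ}
    (hW : Measurable W) (hWi : Integrable W (μ.prod μ)) :
    cutNorm μ' (fun p => W (φ p.1, φ p.2)) ≤ cutNorm μ W := by
  refine cutNorm_le fun S T hS hT => ?_
  have hle : ∀ S, (μ'.restrict S).map φ ≤ μ := fun S => by
    conv_rhs => rw [← hφ.map_eq]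
    exact Measure.map_mono Measure.restrict_le_self hφ.measurable
  obtain ⟨f, hf, hf01, hfe⟩ := Measure.exists_eq_withDensity_of_le (hle S)
  obtain ⟨g, hg, hg01, hge⟩ := Measure.exists_eq_withDensity_of_le (hle T)
  have e : ∫ p in S ×ˢ T, W (φ p.1, φ p.2) ∂(μ'.prod μ')
      = ∫ p, f p.1 * g p.2 * W p ∂(μ.prod μ) := by
    calc ∫ p in S ×ˢ T, W (φ p.1, φ p.2) ∂(μ'.prod μ')
        = ∫ p, W p ∂(((μ'.restrict S).map φ).prod ((μ'.restrict T).map φ)) := by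
          rw [Measure.map_prod_map _ _ hφ.measurable hφ.measurable, integral_map
            (hφ.measurable.prodMap hφ.measurable).aemeasurable hW.aestronglyMeasurable,
            Measure.prod_restrict]
          rfl
      _ = _ := by
          rw [hfe, hge, prod_withDensity hf.ennreal_ofReal hg.ennreal_ofReal,
            integral_withDensity_eq_integral_toReal_smul]
          · refine integral_congr_ae (Filter.Eventually.of_forall fun p => ?_)
            simp only [ENNReal.toReal_mul, ENNReal.toReal_ofReal (hf01 _).1,
              ENNReal.toReal_ofReal (hg01 _).1, smul_eq_mul]
          · exact (hf.ennreal_ofReal.comp measurable_fst).mul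
              (hg.ennreal_ofReal.comp measurable_snd)
          · exact Filter.Eventually.of_forall fun p =>
              ENNReal.mul_lt_top ENNReal.ofReal_lt_top ENNReal.ofReal_lt_top
  rw [e]
  exact abs_integral_mul_mul_le_cutNorm hWi hf hf01 hg hg01

end CutNorm

/-! ### Step functions and their density in `L¹`. -/

/-- A function on `Ω × Ω` that is constant on the boxes of a measurable partition of `Ω` into
`n` parts. -/
def IsStep {Ω : Type*} [MeasurableSpace Ω] (n : ℕ) (V : Ω × Ω → ℝ) : Prop :=
  ∃ f : Ω → Fin n, Measurable f ∧ ∃ U : Fin n → Fin n → ℝ, V = fun p => U (f p.1) (f p.2)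

section Step

variable {Ω : Type*} [MeasurableSpace Ω]

theorem measurable_comp_fin_prod {ι : Type*} [MeasurableSpace ι] [DiscreteMeasurableSpace ι]
    [Countable ι] {f : Ω → ι} (hf : Measurable f) (U : ι → ι → ℝ) :
    Measurable fun p : Ω × Ω => U (f p.1) (f p.2) :=
  (measurable_of_countable (fun q : ι × ι => U q.1 q.2)).comp
    ((hf.comp measurable_fst).prodMk (hf.comp measurable_snd))

theorem integrable_comp_fin_prod {ι : Type*} [MeasurableSpace ι] [DiscreteMeasurableSpace ι]
    [Finite ι] {f : Ω → ι} (hf : Measurable f) (U : ι → ι → ℝ)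
    {μ : Measure (Ω × Ω)} [IsFiniteMeasure μ] :
    Integrable (fun p : Ω × Ω => U (f p.1) (f p.2)) μ := by
  have := Fintype.ofFinite ι
  refine Integrable.of_bound (C := ∑ q : ι × ι, |U q.1 q.2|)
    (measurable_comp_fin_prod hf U).aestronglyMeasurable (Filter.Eventually.of_forall fun p => ?_)
  exact Finset.single_le_sum (f := fun q : ι × ι => |U q.1 q.2|) (fun q _ => abs_nonneg _)
    (Finset.mem_univ (f p.1, f p.2))

namespace IsStep

theorem measurable {n : ℕ} {V : Ω × Ω → ℝ} (h : IsStep n V) : Measurable V := by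
  obtain ⟨f, hf, U, rfl⟩ := h
  exact measurable_comp_fin_prod hf U

theorem integrable {n : ℕ} {V : Ω × Ω → ℝ} (h : IsStep n V) {μ : Measure (Ω × Ω)}
    [IsFiniteMeasure μ] : Integrable V μ := by
  obtain ⟨f, hf, U, rfl⟩ := h
  exact integrable_comp_fin_prod hf U

theorem map₂ {n m : ℕ} {V W : Ω × Ω → ℝ} (hV : IsStep n V) (hW : IsStep m W) (h : ℝ → ℝ → ℝ) :
    IsStep (n * m) fun p => h (V p) (W p) := by
  obtain ⟨f, hf, U, rfl⟩ := hV
  obtain ⟨g, hg, U', rfl⟩ := hW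
  refine ⟨fun x => finProdFinEquiv (f x, g x), (measurable_of_finite _).comp (hf.prodMk hg),
    fun i j => h (U (finProdFinEquiv.symm i).1 (finProdFinEquiv.symm j).1)
      (U' (finProdFinEquiv.symm i).2 (finProdFinEquiv.symm j).2), ?_⟩
  simp only [Equiv.symm_apply_apply]

theorem map {n : ℕ} {V : Ω × Ω → ℝ} (hV : IsStep n V) (h : ℝ → ℝ) :
    IsStep n fun p => h (V p) := by
  obtain ⟨f, hf, U, rfl⟩ := hV
  exact ⟨f, hf, fun i j => h (U i j), rfl⟩

theorem mono {n m : ℕ} {V : Ω × Ω → ℝ} (hV : IsStep n V) (hn : n ≠ 0) (hnm : n ≤ m) :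
    IsStep m V := by
  obtain ⟨f, hf, U, rfl⟩ := hV
  have : NeZero n := ⟨hn⟩
  -- Labels from `n` on are never attained; reduction modulo `n` merely gives them some value.
  refine ⟨fun x => Fin.castLE hnm (f x), (measurable_of_finite (Fin.castLE hnm)).comp hf,
    fun i j => U (Fin.ofNat n i) (Fin.ofNat n j), ?_⟩
  simp [Fin.ofNat, Nat.mod_eq_of_lt]

theorem const (c : ℝ) : IsStep (Ω := Ω) 1 fun _ => c :=
  ⟨fun _ => 0, measurable_const, fun _ _ => c, rfl⟩

theorem indicator_prod {S T : Set Ω} (hS : MeasurableSet S) (hT : MeasurableSet T) :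
    IsStep 4 ((S ×ˢ T).indicator 1) := by
  classical
  have key : ∀ S : Set Ω, MeasurableSet S → Measurable fun x => if x ∈ S then (1 : Fin 2) else 0 :=
    fun S hS => Measurable.ite hS measurable_const measurable_const
  have h₁ : IsStep 2 fun p : Ω × Ω => if p.1 ∈ S then 1 else 0 :=
    ⟨_, key S hS, fun i _ => if i = 1 then 1 else 0, by ext p; split_ifs <;> simp_all⟩
  have h₂ : IsStep 2 fun p : Ω × Ω => if p.2 ∈ T then 1 else 0 :=
    ⟨_, key T hT, fun _ i => if i = 1 then 1 else 0, by ext p; split_ifs <;> simp_all⟩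
  convert h₁.map₂ h₂ (· * ·) using 1
  ext p
  by_cases h : p.1 ∈ S <;> by_cases h' : p.2 ∈ T <;> simp [indicator, h, h']

end IsStep

theorem isSetAlgebra_isStep :
    IsSetAlgebra {A : Set (Ω × Ω) | ∃ n, IsStep n (A.indicator (1 : Ω × Ω → ℝ))} where
  empty_mem := ⟨1, by simpa using IsStep.const 0⟩
  compl_mem := by
    rintro A ⟨n, hn⟩
    refine ⟨n, ?_⟩
    convert hn.map (1 - ·) using 1
    ext p
    by_cases h : p ∈ A <;> simp [h]
  union_mem := by
    rintro A B ⟨n, hn⟩ ⟨m, hm⟩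
    refine ⟨n * m, ?_⟩
    convert hn.map₂ hm max using 1
    ext p
    by_cases h : p ∈ A <;> by_cases h' : p ∈ B <;> simp [h, h']

theorem measureDense_isStep (μ : Measure (Ω × Ω)) [IsFiniteMeasure μ] :
    μ.MeasureDense {A : Set (Ω × Ω) | ∃ n, IsStep n (A.indicator (1 : Ω × Ω → ℝ))} := by
  refine Measure.MeasureDense.of_generateFrom_isSetAlgebra_finite _ isSetAlgebra_isStep ?_
  apply le_antisymm
  · rw [← generateFrom_prod]
    refine MeasurableSpace.generateFrom_mono ?_
    rintro _ ⟨S, hS, T, hT, rfl⟩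
    exact ⟨4, IsStep.indicator_prod hS hT⟩
  · refine MeasurableSpace.generateFrom_le ?_
    rintro A ⟨n, hn⟩
    have := hn.measurable (measurableSet_singleton 1)
    convert this
    ext p
    by_cases h : p ∈ A <;> simp [h]

/-- Step functions are dense in `L¹` of the square. -/
theorem MeasureTheory.Integrable.exists_isStep_integral_abs_sub_le {μ : Measure (Ω × Ω)}
    [IsFiniteMeasure μ] {W : Ω × Ω → ℝ} (hW : Integrable W μ) {ε : ℝ} (hε : 0 < ε) :
    ∃ n V, IsStep n V ∧ ∫ p, |W p - V p| ∂μ ≤ ε := by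
  have hd := measureDense_isStep μ
  refine (MemLp.induction_dense (p := 1) (by simp)
    (fun V : Ω × Ω → ℝ => ∃ n, IsStep n V) ?_ ?_ ?_ (memLp_one_iff_integrable.2 hW)
    (ε := ENNReal.ofReal ε) (by simpa using hε)).elim ?_
  · intro c A hA _ δ hδ
    obtain ⟨δ', hδ', hδδ⟩ : ∃ δ' : ℝ, 0 < δ' ∧ ENNReal.ofReal δ' * ‖c‖ₑ ≤ δ := by
      rcases eq_or_ne δ ⊤ with rfl | hδt
      · exact ⟨1, one_pos, le_top⟩
      -- The added 1 covers `c = 0`.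
      · refine ⟨δ.toReal / (‖c‖ + 1), by have := ENNReal.toReal_pos hδ hδt; positivity, ?_⟩
        rw [← ofReal_norm, ← ENNReal.ofReal_mul (by positivity)]
        refine ENNReal.ofReal_le_of_le_toReal ?_
        rw [div_mul_eq_mul_div, div_le_iff₀ (by positivity)]
        nlinarith [ENNReal.toReal_nonneg (a := δ), norm_nonneg c]
    obtain ⟨B, ⟨n, hn⟩, hB⟩ := hd.approx A hA (measure_ne_top _ _) δ' hδ'
    refine ⟨B.indicator fun _ => c, ?_, n, ?_⟩
    · rw [eLpNorm_one_eq_lintegral_enorm]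
      calc ∫⁻ p, ‖(B.indicator (fun _ => c) - A.indicator fun _ => c) p‖ₑ ∂μ
          = ∫⁻ p, (symmDiff A B).indicator (fun _ => ‖c‖ₑ) p ∂μ := by
            congr 1
            ext p
            by_cases h : p ∈ A <;> by_cases h' : p ∈ B <;> simp [h, h', mem_symmDiff]
        _ ≤ ‖c‖ₑ * μ (symmDiff A B) := lintegral_indicator_const_le _ _
        _ ≤ δ := by
            rw [mul_comm]
            exact (mul_le_mul_left hB.le _).trans hδδ
    · convert hn.map (c * ·) using 1
      ext p
      by_cases h : p ∈ B <;> simp [h]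
  · rintro f g ⟨n, hn⟩ ⟨m, hm⟩
    exact ⟨_, hn.map₂ hm (· + ·)⟩
  · rintro f ⟨n, hn⟩
    exact hn.measurable.aestronglyMeasurable
  · rintro V ⟨hV, n, hn⟩
    refine ⟨n, V, hn, ?_⟩
    rw [eLpNorm_one_eq_lintegral_enorm, ← ofReal_integral_norm_eq_lintegral_enorm
      (hW.sub hn.integrable)] at hV
    exact (ENNReal.ofReal_le_ofReal_iff hε.le).1 hV

end Step

/-! ### Weak regularity by energy decrement. -/

section Regularity

theorem integrable_of_mem_Icc {Ω : Type*} [MeasurableSpace Ω] {μ : Measure Ω} [IsFiniteMeasure μ]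
    {W : Ω → ℝ} (hW : Measurable W) (h : ∀ p, W p ∈ Icc (0 : ℝ) 1) : Integrable W μ :=
  Integrable.of_mem_Icc 0 1 hW.aemeasurable (Filter.Eventually.of_forall h)

theorem abs_sub_le_one_of_mem_Icc {a b : ℝ} (ha : a ∈ Icc (0 : ℝ) 1) (hb : b ∈ Icc (0 : ℝ) 1) :
    |a - b| ≤ 1 := abs_le.2 ⟨by linarith [ha.1, hb.2], by linarith [ha.2, hb.1]⟩

/-- Projection to `[0,1]` does not increase the distance to a point of `[0,1]`, so truncating a step
function costs no energy. -/
theorem sq_sub_max_min_le {w v : ℝ} (hw : w ∈ Icc (0 : ℝ) 1) :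
    (w - max 0 (min 1 v)) ^ 2 ≤ (w - v) ^ 2 := by
  obtain ⟨h0, h1⟩ := hw
  rcases le_total v 1 with h | h <;> rcases le_total 0 v with h' | h' <;>
    simp [h, h'] <;> nlinarith

variable {Ω : Type u} [MeasurableSpace Ω] {μ : Measure Ω} [IsProbabilityMeasure μ]

/-- Let `a` be the integral of `W - V` over a rectangle with `|a| > ε`. Adding `a` times its
indicator changes the energy by `-2a²` plus `a²` times the measure of the rectangle, hence by at
most `-a²`. The indicator is a step function on 4 cells. -/
theorem exists_step_energy_decrement {W V : Ω × Ω → ℝ} {n : ℕ} {ε : ℝ} (hε : 0 < ε)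
    (hW : Measurable W) (hW01 : ∀ p, W p ∈ Icc (0 : ℝ) 1) (hV : IsStep n V)
    (hV01 : ∀ p, V p ∈ Icc (0 : ℝ) 1) (h : ε < cutNorm μ fun p => W p - V p) :
    ∃ V', IsStep (n * 4) V' ∧ (∀ p, V' p ∈ Icc (0 : ℝ) 1) ∧
      ∫ p, (W p - V' p) ^ 2 ∂(μ.prod μ) ≤ ∫ p, (W p - V p) ^ 2 ∂(μ.prod μ) - ε ^ 2 := by
  obtain ⟨S, T, hS, hT, hST⟩ : ∃ S T, MeasurableSet S ∧ MeasurableSet T ∧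
      ε < |∫ p in S ×ˢ T, (W p - V p) ∂(μ.prod μ)| := by
    by_contra! hc
    exact absurd (cutNorm_le hc) (not_le.2 h)
  set a := ∫ p in S ×ˢ T, (W p - V p) ∂(μ.prod μ) with ha
  set D : Ω × Ω → ℝ := fun p => W p - V p with hD
  set I : Ω × Ω → ℝ := (S ×ˢ T).indicator 1 with hI
  have hDm : Measurable D := hW.sub hV.measurable
  have hDb : ∀ p, |D p| ≤ 1 := fun p => abs_sub_le_one_of_mem_Icc (hW01 p) (hV01 p)
  have hDi : Integrable D (μ.prod μ) :=
    Integrable.of_bound hDm.aestronglyMeasurable 1 (Filter.Eventually.of_forall hDb)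
  have hD2 : Integrable (fun p => D p ^ 2) (μ.prod μ) :=
    Integrable.of_bound (hDm.pow_const 2).aestronglyMeasurable 1
      (Filter.Eventually.of_forall fun p => by
        rw [Real.norm_eq_abs, abs_pow]; exact pow_le_one₀ (abs_nonneg _) (hDb p))
  have hIi : Integrable I (μ.prod μ) :=
    (integrable_const (1 : ℝ)).indicator (hS.prod hT)
  have hDI : Integrable (fun p => (S ×ˢ T).indicator D p) (μ.prod μ) :=
    hDi.indicator (hS.prod hT)
  have hstep : IsStep (n * 4) fun p => max 0 (min 1 (V p + a * I p)) :=
    hV.map₂ (IsStep.indicator_prod hS hT) fun v i => max 0 (min 1 (v + a * i))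
  refine ⟨_, hstep, fun p => ⟨le_max_left _ _, max_le zero_le_one (min_le_left _ _)⟩, ?_⟩
  have hI1 : ∫ p, I p ∂(μ.prod μ) ≤ 1 := by
    rw [hI, integral_indicator_one (hS.prod hT)]
    exact measureReal_le_one
  have hexp : ∀ p, (W p - (V p + a * I p)) ^ 2
      = D p ^ 2 - 2 * a * (S ×ˢ T).indicator D p + a ^ 2 * I p := by
    intro p
    by_cases hp : p ∈ S ×ˢ T
    · simp only [hI, hD, hp, indicator_of_mem, Pi.one_apply]; ring
    · simp only [hI, hD, hp, not_false_eq_true, indicator_of_notMem]; ring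
  have hint : Integrable (fun p => D p ^ 2 - 2 * a * (S ×ˢ T).indicator D p + a ^ 2 * I p)
      (μ.prod μ) := (hD2.sub (hDI.const_mul _)).add (hIi.const_mul _)
  calc ∫ p, (W p - max 0 (min 1 (V p + a * I p))) ^ 2 ∂(μ.prod μ)
      ≤ ∫ p, (D p ^ 2 - 2 * a * (S ×ˢ T).indicator D p + a ^ 2 * I p) ∂(μ.prod μ) := by
        refine integral_mono_of_nonneg (Filter.Eventually.of_forall fun p => sq_nonneg _) hint
          (Filter.Eventually.of_forall fun p => ?_)
        simp only
        rw [← hexp]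
        exact sq_sub_max_min_le (hW01 p)
    _ = ∫ p, D p ^ 2 ∂(μ.prod μ) - 2 * a * a + a ^ 2 * ∫ p, I p ∂(μ.prod μ) := by
        have h1 : Integrable (fun p => D p ^ 2 - 2 * a * (S ×ˢ T).indicator D p) (μ.prod μ) :=
          hD2.sub (hDI.const_mul _)
        rw [integral_add h1 (hIi.const_mul _), integral_sub hD2 (hDI.const_mul _), integral_const_mul, integral_const_mul,
          integral_indicator (hS.prod hT)]
    _ ≤ _ := by
        have : ε ^ 2 ≤ a ^ 2 := by rw [← sq_abs a]; gcongr
        nlinarith [sq_nonneg a]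

/-- Energy is nonnegative, so a budget of `k ε²` allows at most `k` decrements; one factor 4 is to
spare. -/
theorem exists_step_cutNorm_le_of_energy_le {W : Ω × Ω → ℝ} {ε : ℝ} (hε : 0 < ε)
    (hW : Measurable W) (hW01 : ∀ p, W p ∈ Icc (0 : ℝ) 1) (k : ℕ) :
    ∀ {n : ℕ} {V : Ω × Ω → ℝ}, n ≠ 0 → IsStep n V → (∀ p, V p ∈ Icc (0 : ℝ) 1) →
      ∫ p, (W p - V p) ^ 2 ∂(μ.prod μ) ≤ k * ε ^ 2 →
      ∃ V', IsStep (n * 4 ^ (k + 1)) V' ∧ (∀ p, V' p ∈ Icc (0 : ℝ) 1) ∧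
        cutNorm μ (fun p => W p - V' p) ≤ ε := by
  induction k with
  | zero =>
    intro n V hn hV hV01 hE
    refine ⟨V, hV.mono hn (by omega), hV01, ?_⟩
    by_contra! hc
    obtain ⟨V', -, -, h⟩ := exists_step_energy_decrement hε hW hW01 hV hV01 hc
    have : 0 ≤ ∫ p, (W p - V' p) ^ 2 ∂(μ.prod μ) := integral_nonneg fun p => sq_nonneg _
    push_cast at hE
    nlinarith [pow_pos hε 2]
  | succ k ih =>
    intro n V hn hV hV01 hE
    by_cases hc : cutNorm μ (fun p => W p - V p) ≤ ε
    · exact ⟨V, hV.mono hn (Nat.le_mul_of_pos_right _ (by positivity)), hV01, hc⟩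
    · obtain ⟨V', hV', hV'01, h⟩ :=
        exists_step_energy_decrement hε hW hW01 hV hV01 (not_le.1 hc)
      obtain ⟨V'', h1, h2, h3⟩ := ih (by omega) hV' hV'01 (by push_cast at hE; linarith)
      refine ⟨V'', ?_, h2, h3⟩
      convert h1 using 1
      ring

/-- The weak regularity lemma of Frieze and Kannan, for kernels on arbitrary probability spaces. -/
theorem exists_step_cutNorm_le {ε : ℝ} (hε : 0 < ε) :
    ∃ n : ℕ, ∀ {Ω : Type u} [MeasurableSpace Ω] (μ : Measure Ω) [IsProbabilityMeasure μ]
      (W : Ω × Ω → ℝ), Measurable W → (∀ p, W p ∈ Icc (0 : ℝ) 1) →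
      ∃ V, IsStep n V ∧ (∀ p, V p ∈ Icc (0 : ℝ) 1) ∧ cutNorm μ (fun p => W p - V p) ≤ ε := by
  obtain ⟨k, hk⟩ := exists_nat_ge (1 / ε ^ 2)
  refine ⟨1 * 4 ^ (k + 1), fun {Ω} _ μ _ W hW hW01 => ?_⟩
  -- Starting from `V = 0` the energy is at most `1 ≤ k ε²`, with `k` independent of the space and
  -- of `W`.
  refine exists_step_cutNorm_le_of_energy_le hε hW hW01 k one_ne_zero (IsStep.const 0)
    (fun _ => ⟨le_rfl, zero_le_one⟩) ?_
  have h1 : ∫ p, (W p - 0) ^ 2 ∂(μ.prod μ) ≤ ∫ _p, (1 : ℝ) ∂(μ.prod μ) := by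
    refine integral_mono_of_nonneg (Filter.Eventually.of_forall fun p => sq_nonneg _)
      (integrable_const _) (Filter.Eventually.of_forall fun p => ?_)
    simp only [sub_zero]
    exact pow_le_one₀ (hW01 p).1 (hW01 p).2
  simp only [integral_const, probReal_univ, smul_eq_mul, mul_one] at h1
  have h2 := (div_le_iff₀ (by positivity)).1 hk
  linarith

end Regularity

/-! ### Coupling probability spaces through finite labels. -/

section Gluing

/-- Two probability vectors have a coupling that is off the diagonal with probability at most
their `ℓ¹`-distance. -/
theorem exists_discrete_coupling {ι : Type*} [Fintype ι] [DecidableEq ι] {p q : ι → ℝ}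
    (hp : ∀ i, 0 ≤ p i) (hq : ∀ i, 0 ≤ q i) (hpq : ∑ i, p i = ∑ i, q i) :
    ∃ π : ι → ι → ℝ, (∀ i j, 0 ≤ π i j) ∧ (∀ i, ∑ j, π i j = p i) ∧ (∀ j, ∑ i, π i j = q j) ∧
      ∑ i, ∑ j, (if i = j then 0 else π i j) ≤ ∑ i, |p i - q i| := by
  -- The common mass `c` stays on the diagonal, and the residuals, both of total mass `r`, are
  -- coupled independently.
  set c : ι → ℝ := fun i => min (p i) (q i) with hc
  set r : ℝ := ∑ i, (p i - c i) with hr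
  have hr' : ∑ i, (q i - c i) = r := by
    simp only [hr, Finset.sum_sub_distrib, hpq]
  have hpc : ∀ i, 0 ≤ p i - c i := fun i => sub_nonneg.2 (min_le_left _ _)
  have hqc : ∀ i, 0 ≤ q i - c i := fun i => sub_nonneg.2 (min_le_right _ _)
  have hr0 : 0 ≤ r := Finset.sum_nonneg fun i _ => hpc i
  -- This also covers `r = 0`, where the residuals vanish and the quotient by `r` is 0 by
  -- convention.
  have key : ∀ t : ι → ℝ, (∀ i, 0 ≤ t i) → ∑ i, t i = r → ∀ i, t i * r / r = t i := by
    intro t ht htr i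
    by_cases h0 : r = 0
    · rw [h0] at htr
      rw [(Finset.sum_eq_zero_iff_of_nonneg fun i _ => ht i).1 htr i (Finset.mem_univ i)]
      simp
    · field_simp
  refine ⟨fun i j => (if i = j then c i else 0) + (p i - c i) * (q j - c j) / r,
    fun i j => ?_, fun i => ?_, fun j => ?_, ?_⟩
  · have : 0 ≤ (if i = j then c i else 0) := by
      split_ifs
      · exact le_min (hp i) (hq i)
      · exact le_rfl
    have := hpc i
    have := hqc j
    positivity
  · rw [Finset.sum_add_distrib, Finset.sum_ite_eq, if_pos (Finset.mem_univ i), ← Finset.sum_div,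
      ← Finset.mul_sum, hr', key _ hpc rfl]
    ring
  · rw [Finset.sum_add_distrib, Finset.sum_ite_eq', if_pos (Finset.mem_univ j), ← Finset.sum_div,
      ← Finset.sum_mul, ← hr, mul_comm, key _ hqc hr']
    ring
  · calc ∑ i, ∑ j, (if i = j then 0 else
          (if i = j then c i else 0) + (p i - c i) * (q j - c j) / r)
        ≤ ∑ i, ∑ j, (p i - c i) * (q j - c j) / r := by
          gcongr with i _ j _
          have := hpc i
          have := hqc j
          split_ifs
          · positivity
          · simp
      _ = ∑ i, (p i - c i) := by
          refine Finset.sum_congr rfl fun i _ => ?_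
          rw [← Finset.sum_div, ← Finset.mul_sum, hr', key _ hpc rfl]
      _ ≤ ∑ i, |p i - q i| := by
          gcongr with i _
          simp only [hc]
          rcases le_total (p i) (q i) with h | h <;> simp [h, le_abs_self]

theorem ae_measureReal_fiber_ne_zero {X ι : Type*} [MeasurableSpace X] [Finite ι]
    {μ : Measure X} [IsFiniteMeasure μ] (f : X → ι) :
    ∀ᵐ x ∂μ, μ.real (f ⁻¹' {f x}) ≠ 0 := by
  have : ∀ᵐ x ∂μ, ∀ i, f x = i → μ.real (f ⁻¹' {i}) ≠ 0 := by
    rw [ae_all_iff]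
    intro i
    by_cases h : μ.real (f ⁻¹' {i}) = 0
    · rw [measureReal_eq_zero_iff] at h
      rw [ae_iff]
      refine measure_mono_null (fun x hx => ?_) h
      simp only [mem_ofPred_eq, Classical.not_imp] at hx
      exact hx.1
    · exact Filter.Eventually.of_forall fun _ _ => h
  filter_upwards [this] with x hx using hx _ rfl

variable {X Y ι : Type*} [MeasurableSpace X] [MeasurableSpace Y] [Fintype ι] [MeasurableSpace ι]
  [DiscreteMeasurableSpace ι]

theorem lintegral_comp_fintype {ν : Measure Y} {g : Y → ι} (hg : Measurable g)
    (w : ι → ENNReal) : ∫⁻ y, w (g y) ∂ν = ∑ j, w j * ν (g ⁻¹' {j}) := by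
  rw [← lintegral_map (measurable_of_countable w) hg, lintegral_fintype]
  simp only [Measure.map_apply hg (measurableSet_singleton _)]

/-- This computes the marginals of the glued measure: `a` is a row or column of the discrete
coupling and `s` its sum. Null cells of `g` must carry no mass of `a`, because the density divides
by their measure. -/
theorem lintegral_coupling_density {ν : Measure Y} [IsProbabilityMeasure ν] {g : Y → ι}
    (hg : Measurable g) {a : ι → ℝ} (ha : ∀ j, 0 ≤ a j)
    (haq : ∀ j, ν.real (g ⁻¹' {j}) = 0 → a j = 0) {s : ℝ} (has : ∑ j, a j = s) (hs : s ≠ 0) :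
    ∫⁻ y, ENNReal.ofReal (a (g y) / (s * ν.real (g ⁻¹' {g y}))) ∂ν = 1 := by
  have hs0 : 0 ≤ s := has ▸ Finset.sum_nonneg fun j _ => ha j
  rw [lintegral_comp_fintype hg fun j => ENNReal.ofReal (a j / (s * ν.real (g ⁻¹' {j})))]
  have : ∀ j, ENNReal.ofReal (a j / (s * ν.real (g ⁻¹' {j}))) * ν (g ⁻¹' {j})
      = ENNReal.ofReal (a j / s) := by
    intro j
    rw [← ofReal_measureReal, ← ENNReal.ofReal_mul
      (div_nonneg (ha j) (mul_nonneg hs0 measureReal_nonneg))]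
    congr 1
    by_cases h0 : ν.real (g ⁻¹' {j}) = 0
    · simp [haq j h0]
    · field_simp
  simp only [this]
  rw [← ENNReal.ofReal_sum_of_nonneg fun j _ => div_nonneg (ha j) hs0, ← Finset.sum_div, has,
    div_self hs, ENNReal.ofReal_one]

theorem sum_measureReal_fiber (μ : Measure X) [IsProbabilityMeasure μ] {f : X → ι}
    (hf : Measurable f) : ∑ i, μ.real (f ⁻¹' {i}) = 1 := by
  rw [sum_measureReal_preimage_singleton _ fun i _ => hf (measurableSet_singleton i)]
  simp

/-- Two probability spaces with maps to the same finite set can be coupled so that the two maps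
disagree with probability at most the `ℓ¹`-distance of their laws. -/
theorem exists_gluing (μ : Measure X) [IsProbabilityMeasure μ] (ν : Measure Y)
    [IsProbabilityMeasure ν] {f : X → ι} {g : Y → ι} (hf : Measurable f) (hg : Measurable g) :
    ∃ ρ : Measure (X × Y), IsProbabilityMeasure ρ ∧ MeasurePreserving Prod.fst ρ μ ∧
      MeasurePreserving Prod.snd ρ ν ∧
      ρ.real {z | f z.1 ≠ g z.2} ≤ ∑ i, |μ.real (f ⁻¹' {i}) - ν.real (g ⁻¹' {i})| := by
  classical
  set p : ι → ℝ := fun i => μ.real (f ⁻¹' {i}) with hp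
  set q : ι → ℝ := fun i => ν.real (g ⁻¹' {i}) with hq
  obtain ⟨π, hπ0, hπp, hπq, hπ⟩ := exists_discrete_coupling (p := p) (q := q)
    (fun i => measureReal_nonneg) (fun i => measureReal_nonneg)
    ((sum_measureReal_fiber μ hf).trans (sum_measureReal_fiber ν hg).symm)
  have hpz : ∀ i j, p i = 0 → π i j = 0 := fun i j h =>
    (Finset.sum_eq_zero_iff_of_nonneg fun j _ => hπ0 i j).1 ((hπp i).trans h) j (Finset.mem_univ j)
  have hqz : ∀ i j, q j = 0 → π i j = 0 := fun i j h =>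
    (Finset.sum_eq_zero_iff_of_nonneg fun i _ => hπ0 i j).1 ((hπq j).trans h) i (Finset.mem_univ i)
  -- A pair of cells is chosen according to `π`, then points are drawn independently within the two
  -- cells. This has density `π i j / (p i * q j)` with respect to the product measure.
  set w : ι × ι → ENNReal := fun z => ENNReal.ofReal (π z.1 z.2 / (p z.1 * q z.2)) with hw
  have hfg : Measurable fun z : X × Y => (f z.1, g z.2) :=
    (hf.comp measurable_fst).prodMk (hg.comp measurable_snd)
  have hD : Measurable fun z : X × Y => w (f z.1, g z.2) := (measurable_of_countable w).comp hfg
  have hfst : MeasurePreserving Prod.fst ((μ.prod ν).withDensity fun z => w (f z.1, g z.2)) μ := by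
    refine ⟨measurable_fst, ?_⟩
    ext A hA
    rw [Measure.map_apply measurable_fst hA, withDensity_apply _ (measurable_fst hA),
      ← prod_univ, ← Measure.prod_restrict, Measure.restrict_univ,
      lintegral_prod _ hD.aemeasurable]
    rw [← setLIntegral_one]
    refine lintegral_congr_ae (ae_restrict_of_ae ?_)
    filter_upwards [ae_measureReal_fiber_ne_zero f] with x hx
    exact lintegral_coupling_density hg (hπ0 _) (fun j => hqz _ j) (hπp _) hx
  refine ⟨(μ.prod ν).withDensity fun z => w (f z.1, g z.2), ⟨?_⟩, hfst, ⟨measurable_snd, ?_⟩, ?_⟩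
  · rw [← preimage_univ, hfst.measure_preimage MeasurableSet.univ.nullMeasurableSet, measure_univ]
  · ext A hA
    rw [Measure.map_apply measurable_snd hA, withDensity_apply _ (measurable_snd hA),
      ← univ_prod, ← Measure.prod_restrict, Measure.restrict_univ,
      lintegral_prod_symm _ hD.aemeasurable]
    rw [← setLIntegral_one]
    refine lintegral_congr_ae (ae_restrict_of_ae ?_)
    filter_upwards [ae_measureReal_fiber_ne_zero g] with y hy
    have := lintegral_coupling_density hf (a := fun i => π i (g y)) (fun i => hπ0 i _)
      (fun i => hpz i _) (hπq _) hy
    simpa only [hw, mul_comm] using this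
  · have hne : MeasurableSet {z : X × Y | f z.1 ≠ g z.2} :=
      hfg (MeasurableSet.of_discrete (s := {z : ι × ι | z.1 ≠ z.2}))
    refine ENNReal.toReal_le_of_le_ofReal (Finset.sum_nonneg fun i _ => abs_nonneg _) ?_
    refine le_trans (le_of_eq ?_) (ENNReal.ofReal_le_ofReal hπ)
    rw [withDensity_apply _ hne, ← lintegral_indicator hne]
    have e : ∀ z : X × Y, {z : X × Y | f z.1 ≠ g z.2}.indicator (fun z => w (f z.1, g z.2)) z
        = (fun z : ι × ι => if z.1 = z.2 then 0 else w z) (f z.1, g z.2) := by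
      intro z
      by_cases h : f z.1 = g z.2 <;> simp [h]
    simp only [e]
    rw [lintegral_comp_fintype hfg fun z : ι × ι => if z.1 = z.2 then 0 else w z,
      ← Fintype.sum_prod_type', ENNReal.ofReal_sum_of_nonneg]
    · refine Finset.sum_congr rfl fun z _ => ?_
      have : (fun z : X × Y => (f z.1, g z.2)) ⁻¹' {z} = (f ⁻¹' {z.1}) ×ˢ (g ⁻¹' {z.2}) := by
        ext y
        simp [Prod.ext_iff]
      split_ifs with h
      · simp
      · rw [this, Measure.prod_prod, ← ofReal_measureReal, ← ofReal_measureReal,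
          ← ENNReal.ofReal_mul measureReal_nonneg, ← ENNReal.ofReal_mul
          (div_nonneg (hπ0 _ _) (mul_nonneg measureReal_nonneg measureReal_nonneg))]
        congr 1
        change π z.1 z.2 / (p z.1 * q z.2) * (p z.1 * q z.2) = _
        by_cases h1 : p z.1 = 0
        · simp [hpz _ _ h1]
        by_cases h2 : q z.2 = 0
        · simp [hqz _ _ h2]
        field_simp
    · intro z _
      split_ifs
      · exact le_rfl
      · exact hπ0 _ _

end Gluing

/-! ### Comparing step functions whose labels mostly agree. -/

section StepComparison

variable {Z : Type u} [MeasurableSpace Z] {ρ : Measure Z} [IsProbabilityMeasure ρ]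

/-- Where both coordinates have equal labels the difference is at most `c`; elsewhere it is at most
`M`, and a union bound over the two coordinates gives the factor 2. -/
theorem cutNorm_comp_sub_comp_le {ι : Type*} [Finite ι] [MeasurableSpace ι]
    [DiscreteMeasurableSpace ι] {a b : Z → ι} (ha : Measurable a) (hb : Measurable b)
    {U U' : ι → ι → ℝ} {c M : ℝ} (hc : ∀ i j, |U i j - U' i j| ≤ c)
    (hM : ∀ i j k l, |U i j - U' k l| ≤ M) :
    cutNorm ρ (fun p => U (a p.1) (a p.2) - U' (b p.1) (b p.2)) ≤
      c + 2 * M * ρ.real {z | a z ≠ b z} := by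
  classical
  obtain ⟨z₀⟩ : Nonempty Z := nonempty_of_isProbabilityMeasure ρ
  have hc0 : 0 ≤ c := (abs_nonneg _).trans (hc (a z₀) (a z₀))
  have hM0 : 0 ≤ M := (abs_nonneg _).trans (hM (a z₀) (a z₀) (a z₀) (a z₀))
  have hne : MeasurableSet {z | a z ≠ b z} := (measurableSet_eq_fun ha hb).compl
  have hi : Integrable (fun p : Z × Z => U (a p.1) (a p.2) - U' (b p.1) (b p.2)) (ρ.prod ρ) :=
    (integrable_comp_fin_prod ha U).sub (integrable_comp_fin_prod hb U')
  have h1 : Integrable (fun p : Z × Z => {z | a z ≠ b z}.indicator (fun _ => M) p.1)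
      (ρ.prod ρ) := ((integrable_const M).indicator hne).comp_fst ρ
  have h2 : Integrable (fun p : Z × Z => {z | a z ≠ b z}.indicator (fun _ => M) p.2)
      (ρ.prod ρ) := ((integrable_const M).indicator hne).comp_snd ρ
  calc cutNorm ρ (fun p => U (a p.1) (a p.2) - U' (b p.1) (b p.2))
      ≤ ∫ p, |U (a p.1) (a p.2) - U' (b p.1) (b p.2)| ∂(ρ.prod ρ) := cutNorm_le_integral_abs hi
    _ ≤ ∫ p : Z × Z, (c + ({z | a z ≠ b z}.indicator (fun _ => M) p.1 +
          {z | a z ≠ b z}.indicator (fun _ => M) p.2)) ∂(ρ.prod ρ) := by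
        refine integral_mono hi.abs ((integrable_const c).add (h1.add h2)) fun p => ?_
        have := hM (a p.1) (a p.2) (b p.1) (b p.2)
        by_cases e1 : a p.1 = b p.1 <;> by_cases e2 : a p.2 = b p.2
        · simpa [e1, e2] using hc _ _
        all_goals
          simp only [mem_ofPred_eq, e1, e2, ne_eq, not_true_eq_false, not_false_eq_true,
            indicator_of_notMem, indicator_of_mem] at this ⊢
          linarith
    _ = c + 2 * M * ρ.real {z | a z ≠ b z} := by
        have h12 : Integrable (fun p : Z × Z => {z | a z ≠ b z}.indicator (fun _ => M) p.1 +
          {z | a z ≠ b z}.indicator (fun _ => M) p.2) (ρ.prod ρ) := h1.add h2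
        rw [integral_add (integrable_const c) h12, integral_add h1 h2,
          integral_fun_fst fun z => {z | a z ≠ b z}.indicator (fun _ => M) z,
          integral_fun_snd fun z => {z | a z ≠ b z}.indicator (fun _ => M) z,
          integral_indicator_const _ hne]
        simp
        ring

end StepComparison

/-! ### The cut metric as a pseudometric. -/

namespace CutFunction

theorem integrable_W (K : CutFunction.{u}) : Integrable K.W (K.μ.prod K.μ) :=
  integrable_of_mem_Icc K.measurable_W K.W_mem

theorem integrable_comp {Ω : Type*} [MeasurableSpace Ω] {μ : Measure Ω} [IsProbabilityMeasure μ]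
    (K : CutFunction.{u}) {φ : Ω → K.carrier} (hφ : Measurable φ) :
    Integrable (fun p : Ω × Ω => K.W (φ p.1, φ p.2)) (μ.prod μ) :=
  integrable_of_mem_Icc (K.measurable_W.comp (hφ.prodMap hφ)) fun _ => K.W_mem _

theorem cutDist_le {K₁ K₂ : CutFunction.{u}} {Ω : Type u} [MeasurableSpace Ω] (μ : Measure Ω)
    [h : IsProbabilityMeasure μ] {φ₁ : Ω → K₁.carrier} {φ₂ : Ω → K₂.carrier}
    (h₁ : MeasurePreserving φ₁ μ K₁.μ) (h₂ : MeasurePreserving φ₂ μ K₂.μ) :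
    cutDist K₁ K₂ ≤ cutNorm μ (fun p => K₁.W (φ₁ p.1, φ₁ p.2) - K₂.W (φ₂ p.1, φ₂ p.2)) := by
  refine csInf_le ⟨0, ?_⟩ ⟨Ω, _, μ, h, φ₁, φ₂, h₁, h₂, rfl⟩
  rintro _ ⟨Ω, _, μ, _, φ₁, φ₂, -, -, rfl⟩
  exact cutNorm_nonneg _

theorem exists_cutNorm_lt {K₁ K₂ : CutFunction.{u}} {c : ℝ} (hc : cutDist K₁ K₂ < c) :
    ∃ (Ω : Type u) (_ : MeasurableSpace Ω) (μ : Measure Ω) (_ : IsProbabilityMeasure μ)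
      (φ₁ : Ω → K₁.carrier) (φ₂ : Ω → K₂.carrier),
      MeasurePreserving φ₁ μ K₁.μ ∧ MeasurePreserving φ₂ μ K₂.μ ∧
      cutNorm μ (fun p => K₁.W (φ₁ p.1, φ₁ p.2) - K₂.W (φ₂ p.1, φ₂ p.2)) < c := by
  obtain ⟨_, ⟨Ω, _, μ, _, φ₁, φ₂, h₁, h₂, rfl⟩, h⟩ := exists_lt_of_csInf_lt
    (by exact ⟨_, K₁.carrier × K₂.carrier, inferInstance, K₁.μ.prod K₂.μ,
      inferInstance, Prod.fst, Prod.snd, measurePreserving_fst, measurePreserving_snd, rfl⟩) hc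
  exact ⟨Ω, _, μ, ‹_›, φ₁, φ₂, h₁, h₂, h⟩

theorem cutDist_nonneg (K₁ K₂ : CutFunction.{u}) : 0 ≤ cutDist K₁ K₂ := by
  refine Real.sInf_nonneg ?_
  rintro _ ⟨Ω, _, μ, _, φ₁, φ₂, -, -, rfl⟩
  exact cutNorm_nonneg _

theorem cutDist_comm_le (K₁ K₂ : CutFunction.{u}) : cutDist K₁ K₂ ≤ cutDist K₂ K₁ := by
  refine le_of_forall_gt_imp_ge_of_dense fun c hc => ?_
  obtain ⟨Ω, _, μ, _, φ₁, φ₂, h₁, h₂, h⟩ := exists_cutNorm_lt hc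
  rw [cutNorm_sub_comm] at h
  exact (cutDist_le μ h₂ h₁).trans h.le

theorem cutDist_comm (K₁ K₂ : CutFunction.{u}) : cutDist K₁ K₂ = cutDist K₂ K₁ :=
  le_antisymm (cutDist_comm_le _ _) (cutDist_comm_le _ _)

theorem cutDist_self (K : CutFunction.{u}) : cutDist K K = 0 := by
  refine le_antisymm ?_ (cutDist_nonneg _ _)
  refine (cutDist_le K.μ (MeasurePreserving.id _) (MeasurePreserving.id _)).trans ?_
  simp [cutNorm_le]

/-- With `f` the cells of an `L¹` step approximation of `K₂`, the labels `f ∘ φ₂` and `f ∘ ψ₂` have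
the same law, so the two couplings glue with labels equal almost surely. Each near-optimal coupling
costs `ε / 4`, and so does each of the two passages between `K₂` and its approximation. -/
theorem cutDist_triangle (K₁ K₂ K₃ : CutFunction.{u}) :
    cutDist K₁ K₃ ≤ cutDist K₁ K₂ + cutDist K₂ K₃ := by
  refine le_of_forall_pos_le_add fun ε hε => ?_
  obtain ⟨X, _, μ, _, φ₁, φ₂, hφ₁, hφ₂, hφ⟩ := exists_cutNorm_lt
    (show cutDist K₁ K₂ < cutDist K₁ K₂ + ε / 4 by linarith)
  obtain ⟨Y, _, ν, _, ψ₂, ψ₃, hψ₂, hψ₃, hψ⟩ := exists_cutNorm_lt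
    (show cutDist K₂ K₃ < cutDist K₂ K₃ + ε / 4 by linarith)
  obtain ⟨n, _, ⟨f, hf, U, rfl⟩, hV⟩ :=
    K₂.integrable_W.exists_isStep_integral_abs_sub_le (show 0 < ε / 4 by linarith)
  obtain ⟨ρ, _, hfst, hsnd, hρ⟩ := exists_gluing μ ν (hf.comp hφ₂.measurable)
    (hf.comp hψ₂.measurable)
  have hWV : Integrable (fun p => K₂.W p - U (f p.1) (f p.2)) (K₂.μ.prod K₂.μ) :=
    K₂.integrable_W.sub (integrable_comp_fin_prod hf U)
  have hWVm : Measurable fun p => K₂.W p - U (f p.1) (f p.2) :=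
    K₂.measurable_W.sub (measurable_comp_fin_prod hf U)
  have hV' := (cutNorm_le_integral_abs hWV).trans hV
  have hp : ∀ i, μ.real ((f ∘ φ₂) ⁻¹' {i}) - ν.real ((f ∘ ψ₂) ⁻¹' {i}) = 0 := by
    intro i
    rw [preimage_comp, preimage_comp, hφ₂.measureReal_preimage, hψ₂.measureReal_preimage, sub_self]
    all_goals exact (hf (measurableSet_singleton i)).nullMeasurableSet
  simp only [hp, abs_zero, Finset.sum_const_zero] at hρ
  have e1 := cutNorm_comp_le hfst
    (W := fun p => K₁.W (φ₁ p.1, φ₁ p.2) - K₂.W (φ₂ p.1, φ₂ p.2))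
    ((K₁.measurable_W.comp (hφ₁.measurable.prodMap hφ₁.measurable)).sub
      (K₂.measurable_W.comp (hφ₂.measurable.prodMap hφ₂.measurable)))
    ((K₁.integrable_comp hφ₁.measurable).sub (K₂.integrable_comp hφ₂.measurable))
  have e2 := cutNorm_comp_le (hφ₂.comp hfst) hWVm hWV
  -- The bound `M` only needs to be finite, as it multiplies the probability of disagreement, which
  -- is 0.
  have e3 : cutNorm ρ (fun p => U (f (φ₂ p.1.1)) (f (φ₂ p.2.1))
      - U (f (ψ₂ p.1.2)) (f (ψ₂ p.2.2))) ≤ 0 := by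
    have hM : ∀ i j k l, |U i j - U k l| ≤ 2 * ∑ z : Fin n × Fin n, |U z.1 z.2| := by
      intro i j k l
      have h := fun i j => Finset.single_le_sum (f := fun z : Fin n × Fin n => |U z.1 z.2|)
        (fun z _ => abs_nonneg _) (Finset.mem_univ (i, j))
      have h1 := h i j
      have h2 := h k l
      simp only at h1 h2
      linarith [abs_sub (U i j) (U k l)]
    have := cutNorm_comp_sub_comp_le (ρ := ρ) (hf.comp (hφ₂.comp hfst).measurable)
      (hf.comp (hψ₂.comp hsnd).measurable) (c := 0) (by simp) hM
    refine this.trans ?_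
    have h0 : ρ.real {z : X × Y | (f ∘ φ₂) z.1 ≠ (f ∘ ψ₂) z.2} = 0 :=
      le_antisymm hρ measureReal_nonneg
    simp only [Function.comp_apply] at h0
    simp [Function.comp_apply, h0]
  have e4 := cutNorm_comp_le (hψ₂.comp hsnd) hWVm hWV
  rw [cutNorm_sub_comm] at e4
  have e5 := cutNorm_comp_le hsnd
    (W := fun p => K₂.W (ψ₂ p.1, ψ₂ p.2) - K₃.W (ψ₃ p.1, ψ₃ p.2))
    ((K₂.measurable_W.comp (hψ₂.measurable.prodMap hψ₂.measurable)).sub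
      (K₃.measurable_W.comp (hψ₃.measurable.prodMap hψ₃.measurable)))
    ((K₂.integrable_comp hψ₂.measurable).sub (K₃.integrable_comp hψ₃.measurable))
  have i1 := K₁.integrable_comp (μ := ρ) (hφ₁.comp hfst).measurable
  have i2 := K₂.integrable_comp (μ := ρ) (hφ₂.comp hfst).measurable
  have i3 := integrable_comp_fin_prod (μ := ρ.prod ρ) (hf.comp (hφ₂.comp hfst).measurable) U
  have i4 := integrable_comp_fin_prod (μ := ρ.prod ρ) (hf.comp (hψ₂.comp hsnd).measurable) U
  have i5 := K₂.integrable_comp (μ := ρ) (hψ₂.comp hsnd).measurable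
  have i6 := K₃.integrable_comp (μ := ρ) (hψ₃.comp hsnd).measurable
  have t0 := cutDist_le ρ (hφ₁.comp hfst) (hψ₃.comp hsnd)
  have t1 := cutNorm_sub_le i1 i2 i6
  have t2 := cutNorm_sub_le i2 i3 i6
  have t3 := cutNorm_sub_le i3 i4 i6
  have t4 := cutNorm_sub_le i4 i5 i6
  simp only [Function.comp_apply] at *
  linarith

/-- Kernels that are close in cut norm to step functions on the same finite set, with close values
and close weights, are close in the cut metric. -/
theorem cutDist_le_of_step {ι : Type*} [Fintype ι] [MeasurableSpace ι] [DiscreteMeasurableSpace ι]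
    (K₁ K₂ : CutFunction.{u}) {f : K₁.carrier → ι} {g : K₂.carrier → ι} (hf : Measurable f)
    (hg : Measurable g) {U U' : ι → ι → ℝ} (hU : ∀ i j, U i j ∈ Icc (0 : ℝ) 1)
    (hU' : ∀ i j, U' i j ∈ Icc (0 : ℝ) 1) {c : ℝ} (hc : ∀ i j, |U i j - U' i j| ≤ c) :
    cutDist K₁ K₂ ≤ cutNorm K₁.μ (fun p => K₁.W p - U (f p.1) (f p.2)) +
      (c + 2 * ∑ i, |K₁.μ.real (f ⁻¹' {i}) - K₂.μ.real (g ⁻¹' {i})|) +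
      cutNorm K₂.μ (fun p => K₂.W p - U' (g p.1) (g p.2)) := by
  obtain ⟨ρ, _, hfst, hsnd, hρ⟩ := exists_gluing K₁.μ K₂.μ hf hg
  have e1 := cutNorm_comp_le hfst (W := fun p => K₁.W p - U (f p.1) (f p.2)) (K₁.measurable_W.sub (measurable_comp_fin_prod hf U))
    (K₁.integrable_W.sub (integrable_comp_fin_prod hf U))
  have e2 := cutNorm_comp_sub_comp_le (ρ := ρ) (hf.comp measurable_fst) (hg.comp measurable_snd)
    hc (M := 1) fun i j k l => abs_sub_le_one_of_mem_Icc (hU i j) (hU' k l)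
  have e3 := cutNorm_comp_le hsnd (W := fun p => K₂.W p - U' (g p.1) (g p.2))
    (K₂.measurable_W.sub (measurable_comp_fin_prod hg U'))
    (K₂.integrable_W.sub (integrable_comp_fin_prod hg U'))
  have i1 := K₁.integrable_comp (μ := ρ) hfst.measurable
  have i2 := integrable_comp_fin_prod (μ := ρ.prod ρ) (hf.comp measurable_fst) U
  have i3 := integrable_comp_fin_prod (μ := ρ.prod ρ) (hg.comp measurable_snd) U'
  have i4 := K₂.integrable_comp (μ := ρ) hsnd.measurable
  have t0 := cutDist_le ρ hfst hsnd
  have t1 := cutNorm_sub_le i1 i2 i4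
  have t2 := cutNorm_sub_le i2 i3 i4
  rw [cutNorm_sub_comm (μ := ρ) (fun p => K₂.W (p.1.2, p.2.2))] at e3
  simp only [Function.comp_apply] at *
  linarith

theorem cutEquiv_equivalence : Equivalence CutEquiv.{u} where
  refl := cutDist_self
  symm := fun h => (cutDist_comm _ _).trans h
  trans := fun {K₁ K₂ K₃} h h' => le_antisymm
    ((cutDist_triangle K₁ K₂ K₃).trans (by rw [h, h', add_zero])) (cutDist_nonneg _ _)

end CutFunction

/-! ### The quotient metric space. -/

namespace CutSpace

open CutFunction

theorem mk_eq_mk {K₁ K₂ : CutFunction.{u}} : mk K₁ = mk K₂ ↔ CutEquiv K₁ K₂ :=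
  ⟨fun h => cutEquiv_equivalence.eqvGen_iff.1 (Quot.eqvGen_exact h), Quot.sound⟩

theorem mk_out (x : CutSpace.{u}) : mk (Quot.out x) = x := Quot.out_eq x

noncomputable instance : MetricSpace CutSpace.{u} where
  dist x y := cutDist (Quot.out x) (Quot.out y)
  dist_self _ := cutDist_self _
  dist_comm _ _ := cutDist_comm _ _
  dist_triangle _ _ _ := cutDist_triangle _ _ _
  eq_of_dist_eq_zero {x y} h := by
    rw [← mk_out x, ← mk_out y]
    exact mk_eq_mk.2 h

theorem dist_mk_mk (K₁ K₂ : CutFunction.{u}) : dist (mk K₁) (mk K₂) = cutDist K₁ K₂ := by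
  change cutDist (Quot.out (mk K₁)) (Quot.out (mk K₂)) = _
  have h₁ : cutDist (Quot.out (mk K₁)) K₁ = 0 := mk_eq_mk.1 (mk_out _)
  have h₂ : cutDist (Quot.out (mk K₂)) K₂ = 0 := mk_eq_mk.1 (mk_out _)
  have h₁' := (cutDist_comm _ _).trans h₁
  have h₂' := (cutDist_comm _ _).trans h₂
  apply le_antisymm
  · linarith [cutDist_triangle (Quot.out (mk K₁)) K₁ (Quot.out (mk K₂)),
      cutDist_triangle K₁ K₂ (Quot.out (mk K₂))]
  · linarith [cutDist_triangle K₁ (Quot.out (mk K₁)) K₂,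
      cutDist_triangle (Quot.out (mk K₁)) (Quot.out (mk K₂)) K₂]

end CutSpace

/-! ### Weak limits and completeness on a fixed space. -/

section WeakLimit

open Filter Topology

/-- A sequence of `[0,1]`-valued functions has a weak cluster point. -/
theorem exists_weak_limit {Z : Type*} [MeasurableSpace Z] (P : Measure Z) [IsProbabilityMeasure P]
    {V : ℕ → Z → ℝ} (hV : ∀ k, Measurable (V k)) (hV01 : ∀ k z, V k z ∈ Icc (0 : ℝ) 1)
    (𝒰 : Ultrafilter ℕ) :
    ∃ W : Z → ℝ, Measurable W ∧ (∀ z, W z ∈ Icc (0 : ℝ) 1) ∧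
      ∀ A, MeasurableSet A → Tendsto (fun k => ∫ z in A, V k z ∂P) 𝒰 (𝓝 (∫ z in A, W z ∂P)) := by
  have hn : ∀ k z, ‖V k z‖ ≤ 1 := fun k z => by
    rw [Real.norm_eq_abs, abs_of_nonneg (hV01 k z).1]; exact (hV01 k z).2
  have hL : ∀ k, MemLp (V k) 2 P := fun k =>
    MemLp.of_bound (hV k).aestronglyMeasurable 1 (Eventually.of_forall (hn k))
  set v : ℕ → Lp ℝ 2 P := fun k => (hL k).toLp with hv
  have hvn : ∀ k, ‖v k‖ ≤ 1 := fun k => by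
    refine (Lp.norm_le_of_ae_bound zero_le_one ?_).trans ?_
    · filter_upwards [(hL k).coeFn_toLp] with z hz
      rw [hz]
      exact hn k z
    · simp [measureUnivNNReal]
  -- Inner products with each `g` stay in a compact interval, so they converge along the
  -- ultrafilter. The limits form a bounded linear functional, which Riesz representation turns into
  -- `w`.
  have hlim : ∀ g : Lp ℝ 2 P, ∃ c ∈ Icc (-‖g‖) ‖g‖, Tendsto (fun k => inner ℝ (v k) g) 𝒰 (𝓝 c) := by
    intro g
    refine isCompact_Icc.ultrafilter_le_nhds (𝒰.map fun k => inner ℝ (v k) g) ?_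
    rw [le_principal_iff, Ultrafilter.coe_map, mem_map]
    refine univ_mem' fun k => abs_le.1 ((abs_real_inner_le_norm _ _).trans ?_)
    exact mul_le_of_le_one_left (norm_nonneg _) (hvn k)
  choose c hc hct using hlim
  let ℓ : Lp ℝ 2 P →ₗ[ℝ] ℝ :=
    { toFun := c
      map_add' := fun g h => tendsto_nhds_unique (hct (g + h)) <| by
        simpa only [inner_add_right] using (hct g).add (hct h)
      map_smul' := fun a g => tendsto_nhds_unique (hct (a • g)) <| by
        simpa only [inner_smul_right, RingHom.id_apply, smul_eq_mul] using (hct g).const_mul a }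
  let L : Lp ℝ 2 P →L[ℝ] ℝ := ℓ.mkContinuous 1 fun g => by
    rw [one_mul]
    exact abs_le.2 (hc g)
  set w : Lp ℝ 2 P := (InnerProductSpace.toDual ℝ _).symm L with hw
  have hwc : ∀ g, inner ℝ w g = c g := fun g => by
    rw [hw, InnerProductSpace.toDual_symm_apply]
    rfl
  have hwA : ∀ A, MeasurableSet A → Tendsto (fun k => ∫ z in A, V k z ∂P) 𝒰
      (𝓝 (∫ z in A, w z ∂P)) := by
    intro A hA
    have h1 := hct (indicatorConstLp 2 hA (measure_ne_top P A) (1 : ℝ))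
    rw [← hwc, real_inner_comm, L2.inner_indicatorConstLp_one] at h1
    refine h1.congr fun k => ?_
    rw [real_inner_comm, L2.inner_indicatorConstLp_one]
    exact integral_congr_ae (ae_restrict_of_ae (hL k).coeFn_toLp)
  have hwi : Integrable w P := (Lp.memLp w).integrable (by norm_num)
  have h0 : ∀ᵐ z ∂P, 0 ≤ w z := by
    refine ae_nonneg_of_forall_setIntegral_nonneg hwi fun A hA _ => ?_
    exact ge_of_tendsto' (hwA A hA) fun k => integral_nonneg fun z => (hV01 k z).1
  have h1 : ∀ᵐ z ∂P, w z ≤ 1 := by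
    refine ae_le_of_forall_setIntegral_le hwi (integrable_const 1) fun A hA _ => ?_
    refine le_of_tendsto' (hwA A hA) fun k => ?_
    exact integral_mono (((hL k).integrable (by norm_num)).integrableOn)
      (integrable_const _) fun z => (hV01 k z).2
  obtain ⟨w', hw'm, hww'⟩ := (Lp.aestronglyMeasurable w)
  -- Truncation changes `w'` only on a null set and puts all its values in `[0,1]`.
  refine ⟨fun z => max 0 (min 1 (w' z)),
    measurable_const.max (measurable_const.min hw'm.measurable),
    fun z => ⟨le_max_left _ _, max_le zero_le_one (min_le_left _ _)⟩, fun A hA => ?_⟩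
  convert hwA A hA using 2
  refine integral_congr_ae (ae_restrict_of_ae ?_)
  filter_upwards [h0, h1, hww'] with z h0 h1 hz
  rw [← hz, min_eq_right h1, max_eq_right h0]

/-- On each rectangle the integral of `W - V k` is a limit of those of `V l - V k`, which are
bounded by `ε l + ε k ≤ 2 * ε k` once `l ≥ k`. -/
theorem exists_cutNorm_limit {Ω : Type u} [MeasurableSpace Ω] (μ : Measure Ω)
    [IsProbabilityMeasure μ] {V : ℕ → Ω × Ω → ℝ} (hV : ∀ k, Measurable (V k))
    (hV01 : ∀ k p, V k p ∈ Icc (0 : ℝ) 1) {ε : ℕ → ℝ} (hε : Antitone ε)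
    (h : ∀ k l, cutNorm μ (fun p => V k p - V l p) ≤ ε k + ε l) :
    ∃ W : Ω × Ω → ℝ, Measurable W ∧ (∀ p, W p ∈ Icc (0 : ℝ) 1) ∧
      ∀ k, cutNorm μ (fun p => W p - V k p) ≤ 2 * ε k := by
  obtain ⟨W, hW, hW01, hlim⟩ := exists_weak_limit (μ.prod μ) hV hV01 (hyperfilter ℕ)
  refine ⟨W, hW, hW01, fun k => cutNorm_le fun S T hS hT => ?_⟩
  have hVi := fun k => integrable_of_mem_Icc (μ := μ.prod μ) (hV k) (hV01 k)
  have hWi := integrable_of_mem_Icc (μ := μ.prod μ) hW hW01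
  have h1 := ((hlim _ (hS.prod hT)).sub_const (∫ p in S ×ˢ T, V k p ∂(μ.prod μ))).abs
  rw [integral_sub hWi.integrableOn (hVi k).integrableOn]
  refine le_of_tendsto h1 ?_
  have h2 : ∀ᶠ l in (hyperfilter ℕ : Filter ℕ), k ≤ l :=
    Nat.hyperfilter_le_atTop (eventually_ge_atTop k)
  filter_upwards [h2] with l hl
  rw [← integral_sub (hVi l).integrableOn (hVi k).integrableOn]
  have h3 := abs_setIntegral_le_cutNorm ((hVi l).sub (hVi k)) hS hT
  have h4 := h l k
  have h5 := hε hl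
  simp only [Pi.sub_def] at h3
  linarith

end WeakLimit

/-! ### Compactness of the cut space. -/

/-- The cut norm of a step function depends continuously on its values and cell weights alone, so
bounds on it survive limits taken across different spaces. -/
theorem cutNorm_step_le {X Y : Type u} [MeasurableSpace X] [MeasurableSpace Y] (μ : Measure X)
    [IsProbabilityMeasure μ] (ν : Measure Y) [IsProbabilityMeasure ν] {ι : Type*} [Fintype ι]
    [MeasurableSpace ι] [DiscreteMeasurableSpace ι] {f : X → ι} {g : Y → ι} (hf : Measurable f)
    (hg : Measurable g) {U U' : ι → ι → ℝ} {c M : ℝ} (hc : ∀ i j, |U i j - U' i j| ≤ c)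
    (hM0 : 0 ≤ M) (hM : ∀ i j k l, |U i j - U' k l| ≤ M) :
    cutNorm ν (fun p => U' (g p.1) (g p.2)) ≤ cutNorm μ (fun p => U (f p.1) (f p.2)) +
      (c + 2 * M * ∑ i, |μ.real (f ⁻¹' {i}) - ν.real (g ⁻¹' {i})|) := by
  obtain ⟨ρ, _, hfst, hsnd, hρ⟩ := exists_gluing μ ν hf hg
  have e1 := cutNorm_comp_le hfst (measurable_comp_fin_prod hf U) (integrable_comp_fin_prod hf U)
  have e2 := cutNorm_comp_sub_comp_le (ρ := ρ) (hf.comp measurable_fst) (hg.comp measurable_snd)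
    hc hM
  have e3 := cutNorm_le_comp hsnd (measurable_comp_fin_prod hg U')
    (integrable_comp_fin_prod hg U')
  have i2 := integrable_comp_fin_prod (μ := ρ.prod ρ) (hf.comp measurable_fst) U
  have i3 := integrable_comp_fin_prod (μ := ρ.prod ρ) (hg.comp measurable_snd) U'
  have e4 := cutNorm_add_le i2 (i3.sub i2)
  simp only [Pi.sub_apply, add_sub_cancel] at e4
  simp only [Pi.sub_def] at e4
  rw [cutNorm_sub_comm] at e4
  have e5 : 2 * M * ρ.real {z | f z.1 ≠ g z.2} ≤
    2 * M * ∑ i, |μ.real (f ⁻¹' {i}) - ν.real (g ⁻¹' {i})| := by gcongr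
  simp only [Function.comp_apply] at *
  linarith

section Compactness

open Filter Topology

/-- Probability measures on a compact space are compact in the weak topology, and clopen sets have
empty boundary, so their measures converge. -/
theorem exists_tendsto_law {α Y : Type*} [TopologicalSpace Y] [MeasurableSpace Y] [T2Space Y]
    [BorelSpace Y] [CompactSpace Y] [HasOuterApproxClosed Y] (F : Ultrafilter α)
    (ν : α → ProbabilityMeasure Y) :
    ∃ ν' : ProbabilityMeasure Y, ∀ E, IsClopen E →
      Tendsto (fun a => (ν a : Measure Y).real E) F (𝓝 ((ν' : Measure Y).real E)) := by
  have h : Tendsto ν F (𝓝 (F.map ν).lim) := (F.map ν).le_nhds_lim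
  refine ⟨(F.map ν).lim, fun E hE => ?_⟩
  have := ProbabilityMeasure.tendsto_measure_of_isClopen_of_tendsto h hE
  exact (NNReal.tendsto_coe.2 this)

namespace CutSpace

open CutFunction

theorem exists_le_nhds (F : Ultrafilter CutSpace.{u}) : ∃ x : CutSpace.{u}, ↑F ≤ 𝓝 x := by
  set ε : ℕ → ℝ := fun k => (1 / 2) ^ k with hε
  have hεpos : ∀ k, 0 < ε k := fun k => by positivity
  choose m hm using fun k => exists_step_cutNorm_le.{u} (hεpos k)
  choose V hV hV01 hVn using fun (q : CutSpace.{u}) k =>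
    hm k (Quot.out q).μ (Quot.out q).W (Quot.out q).measurable_W (Quot.out q).W_mem
  choose f hf U hU using hV
  -- Values at label pairs that are not attained are unconstrained; truncation bounds them without
  -- changing the step function.
  let U₁ : CutSpace.{u} → ∀ k, Fin (m k) → Fin (m k) → ℝ := fun q k i j => max 0 (min 1 (U q k i j))
  have hU₁ : ∀ q k i j, U₁ q k i j ∈ Icc (0 : ℝ) 1 := fun q k i j =>
    ⟨le_max_left _ _, max_le zero_le_one (min_le_left _ _)⟩
  have hUU₁ : ∀ q k, V q k = fun p => U₁ q k (f q k p.1) (f q k p.2) := by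
    intro q k
    ext p
    have := hV01 q k p
    have e := congrFun (hU q k) p
    rw [e] at this ⊢
    simp only [U₁, min_eq_right this.2, max_eq_right this.1]
  have hlim : ∀ k i j, ∃ c ∈ Icc (0 : ℝ) 1, Tendsto (fun q => U₁ q k i j) F (𝓝 c) := fun k i j =>
    isCompact_Icc.ultrafilter_le_nhds (F.map fun q : CutSpace.{u} => U₁ q k i j)
      (le_principal_iff.2 (mem_map.2 (univ_mem' fun q => hU₁ q k i j)))
  choose U' hU' hU'lim using hlim
  have hfm : ∀ q, Measurable fun x k => f q k x := fun q => measurable_pi_iff.2 (hf q)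
  -- The joint law of the labels at all levels is needed, so that all limiting step functions live
  -- on one space.
  obtain ⟨ν, hν⟩ := exists_tendsto_law F fun q : CutSpace.{u} =>
    (⟨(Quot.out q).μ.map fun x k => f q k x, Measure.isProbabilityMeasure_map (hfm q).aemeasurable⟩ :
      ProbabilityMeasure (∀ k, Fin (m k)))
  -- The label space lies in the lowest universe and must be lifted to be a carrier.
  let Y := ULift.{u} (∀ k, Fin (m k))
  let μ : Measure Y := (ν : Measure (∀ k, Fin (m k))).map ULift.up
  have hup : Measurable (ULift.up : (∀ k, Fin (m k)) → Y) := measurable_up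
  have : IsProbabilityMeasure μ := Measure.isProbabilityMeasure_map hup.aemeasurable
  let g : ∀ k, Y → Fin (m k) := fun k y => y.down k
  have hg : ∀ k, Measurable (g k) := fun k => (measurable_pi_apply k).comp measurable_down
  have hlaw : ∀ {ι : Type} [Fintype ι] [MeasurableSpace ι] [DiscreteMeasurableSpace ι]
      [TopologicalSpace ι] [DiscreteTopology ι] {h : (∀ k, Fin (m k)) → ι},
      Continuous h → Measurable h →
      Tendsto (fun q : CutSpace.{u} => ∑ i, |(Quot.out q).μ.real ((fun x => h fun k => f q k x) ⁻¹' {i})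
        - μ.real ((fun y => h y.down) ⁻¹' {i})|) F (𝓝 0) := by
    intro ι _ _ _ _ _ h hc hm
    rw [← Finset.sum_const_zero (s := (Finset.univ : Finset ι))]
    refine tendsto_finsetSum _ fun i _ => ?_
    rw [← abs_zero, ← sub_self (μ.real ((fun y => h y.down) ⁻¹' {i}))]
    refine (Tendsto.sub_const ?_ _).abs
    have hmi : MeasurableSet (h ⁻¹' {i}) := hm (measurableSet_singleton i)
    have := hν (h ⁻¹' {i}) ((isClopen_discrete {i}).preimage hc)
    have e : μ.real ((fun y : Y => h y.down) ⁻¹' {i})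
        = (ν : Measure (∀ k, Fin (m k))).real (h ⁻¹' {i}) :=
      map_measureReal_apply hup (measurable_down hmi)
    rw [e]
    refine this.congr fun q => ?_
    exact map_measureReal_apply (hfm q) hmi
  let d : ℕ → CutSpace.{u} → ℝ := fun k q => ∑ z : Fin (m k) × Fin (m k),
    |U₁ q k z.1 z.2 - U' k z.1 z.2|
  have hd : ∀ k, Tendsto (d k) F (𝓝 0) := fun k => by
    rw [← Finset.sum_const_zero (s := (Finset.univ : Finset (Fin (m k) × Fin (m k))))]
    refine tendsto_finsetSum _ fun z _ => ?_
    rw [← abs_zero, ← sub_self (U' k z.1 z.2)]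
    exact ((hU'lim k z.1 z.2).sub_const _).abs
  have hdle : ∀ k q i j, |U₁ q k i j - U' k i j| ≤ d k q := fun k q i j =>
    Finset.single_le_sum (f := fun z : Fin (m k) × Fin (m k) => |U₁ q k z.1 z.2 - U' k z.1 z.2|)
      (fun z _ => abs_nonneg _) (Finset.mem_univ (i, j))
  -- For each `q` both step functions are close to the same kernel. The cut norm of their difference
  -- is governed by the values and the joint law of the labels at levels `k` and `l`, so the bound
  -- passes to the limit.
  have hcauchy : ∀ k l, cutNorm μ (fun p => U' k (g k p.1) (g k p.2) - U' l (g l p.1) (g l p.2)) ≤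
      ε k + ε l := by
    intro k l
    have t := hlaw (h := fun y => (y k, y l)) (by fun_prop) (by fun_prop)
    have t' := (((hd k).add (hd l)).add (t.const_mul (2 * 2))).const_add (ε k + ε l)
    simp only [mul_zero, add_zero] at t'
    refine ge_of_tendsto' t' fun q => ?_
    have h1 := cutNorm_step_le (Quot.out q).μ μ ((hf q k).prodMk (hf q l)) ((hg k).prodMk (hg l))
      (U := fun a b => U₁ q k a.1 b.1 - U₁ q l a.2 b.2)
      (U' := fun a b => U' k a.1 b.1 - U' l a.2 b.2) (c := d k q + d l q) (M := 2)
      (fun a b => by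
        have h1 := hdle k q a.1 b.1
        have h2 := hdle l q a.2 b.2
        rw [sub_sub_sub_comm]
        exact (abs_sub _ _).trans (add_le_add h1 h2)) zero_le_two
      (fun a b a' b' => by
        have h1 := abs_sub_le_one_of_mem_Icc (hU₁ q k a.1 b.1) (hU₁ q l a.2 b.2)
        have h2 := abs_sub_le_one_of_mem_Icc (hU' k a'.1 b'.1) (hU' l a'.2 b'.2)
        refine (abs_sub _ _).trans ?_
        linarith)
    have h2 := cutNorm_sub_le (integrable_comp_fin_prod (hf q k) (U₁ q k))
      (Quot.out q).integrable_W (integrable_comp_fin_prod (hf q l) (U₁ q l))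
    have h3 := hVn q k
    have h4 := hVn q l
    rw [hUU₁] at h3 h4
    rw [cutNorm_sub_comm] at h3
    refine h1.trans (add_le_add (h2.trans (add_le_add h3 h4)) le_rfl)
  obtain ⟨W, hW, hW01, hWn⟩ := exists_cutNorm_limit μ
    (V := fun k p => U' k (g k p.1) (g k p.2)) (fun k => measurable_comp_fin_prod (hg k) (U' k))
    (fun k p => hU' k _ _)
    (antitone_nat_of_succ_le fun k => by simp only [hε, pow_succ]; linarith [hεpos k]) hcauchy
  let K : CutFunction.{u} := { carrier := Y, μ := μ, W := W, measurable_W := hW, W_mem := hW01 }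
  refine ⟨mk K, ?_⟩
  change Tendsto id (F : Filter CutSpace.{u}) (𝓝 (mk K))
  rw [Metric.tendsto_nhds]
  intro δ hδ
  -- The step errors are `ε k` for `q` and `2 * ε k` for the limit, together below `δ / 2`.
  obtain ⟨k, hk⟩ := exists_pow_lt_of_lt_one (show 0 < δ / 6 by linarith)
    (show (1 / 2 : ℝ) < 1 by norm_num)
  have t := hlaw (h := fun y => y k) (by fun_prop) (by fun_prop)
  have t' := (hd k).add (t.const_mul 2)
  simp only [mul_zero, add_zero] at t'
  filter_upwards [t'.eventually_lt_const (show 0 < δ / 2 by linarith)] with q hq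
  have h1 := cutDist_le_of_step (Quot.out q) K (hf q k) (hg k) (hU₁ q k) (hU' k) (hdle k q)
  have h2 := hVn q k
  rw [hUU₁] at h2
  have h3 := hWn k
  rw [id, ← mk_out q, dist_mk_mk]
  simp only [K, hε] at *
  linarith

instance : CompactSpace CutSpace.{u} where
  isCompact_univ := isCompact_iff_ultrafilter_le_nhds.2 fun F _ =>
    let ⟨x, hx⟩ := exists_le_nhds F
    ⟨x, mem_univ x, hx⟩

end CutSpace

end Compactness

/-! ### Triangle densities and their continuity in cut norm. -/

section CycleDensity

open Filter

variable {Ω : Type u} [MeasurableSpace Ω] (μ : Measure Ω)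

/-- The cyclic rotation `(z, (x, y)) ↦ (x, (y, z))`. -/
def tripleRotation (t : Ω × Ω × Ω) : Ω × Ω × Ω := (t.2.1, t.2.2, t.1)

theorem measurePreserving_tripleRotation [SFinite μ] :
    MeasurePreserving tripleRotation (μ.prod (μ.prod μ)) (μ.prod (μ.prod μ)) :=
  (measurePreserving_prodAssoc μ μ μ).comp
    (Measure.measurePreserving_swap (μ := μ) (ν := μ.prod μ))

theorem measurable_edge₁ : Measurable fun t : Ω × Ω × Ω => t.2 := measurable_snd

theorem measurable_edge₂ : Measurable fun t : Ω × Ω × Ω => (t.2.2, t.1) := by fun_prop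

theorem measurable_edge₃ : Measurable fun t : Ω × Ω × Ω => (t.1, t.2.1) := by fun_prop

/-- The integral of `f(x, y) g(y, z) h(z, x)`; the integration variable is `(z, (x, y))`. -/
noncomputable def triangleDensity (f g h : Ω × Ω → ℝ) : ℝ :=
  ∫ t : Ω × Ω × Ω, f t.2 * g (t.2.2, t.1) * h (t.1, t.2.1) ∂(μ.prod (μ.prod μ))

theorem triangleDensity_comp {Ω' : Type*} [MeasurableSpace Ω'] {μ' : Measure Ω'}
    [SFinite μ'] [SFinite μ] {φ : Ω' → Ω} (hφ : MeasurePreserving φ μ' μ) {f g h : Ω × Ω → ℝ}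
    (hf : Measurable f) (hg : Measurable g) (hh : Measurable h) :
    triangleDensity μ' (fun p => f (φ p.1, φ p.2)) (fun p => g (φ p.1, φ p.2))
      (fun p => h (φ p.1, φ p.2)) = triangleDensity μ f g h := by
  have hm : Measurable fun t : Ω × Ω × Ω => f t.2 * g (t.2.2, t.1) * h (t.1, t.2.1) :=
    ((hf.comp measurable_edge₁).mul (hg.comp measurable_edge₂)).mul (hh.comp measurable_edge₃)
  have hφ3 := hφ.prod (hφ.prod hφ)
  rw [triangleDensity, triangleDensity, ← hφ3.map_eq, integral_map hφ3.measurable.aemeasurable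
      hm.aestronglyMeasurable]
  rfl

variable [IsProbabilityMeasure μ]

theorem triangleDensity_rotate {f g h : Ω × Ω → ℝ} (hf : Measurable f) (hg : Measurable g)
    (hh : Measurable h) : triangleDensity μ f g h = triangleDensity μ g h f := by
  have hm : Measurable fun t : Ω × Ω × Ω => g t.2 * h (t.2.2, t.1) * f (t.1, t.2.1) :=
    ((hg.comp measurable_edge₁).mul (hh.comp measurable_edge₂)).mul (hf.comp measurable_edge₃)
  rw [triangleDensity, triangleDensity, ← (measurePreserving_tripleRotation μ).map_eq,
    integral_map (measurePreserving_tripleRotation μ).measurable.aemeasurable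
      hm.aestronglyMeasurable, (measurePreserving_tripleRotation μ).map_eq]
  congr 1
  ext t
  simp only [tripleRotation]
  ring

variable {μ}

theorem mul_mem_Icc_zero_one {a b : ℝ} (ha : a ∈ Icc (0 : ℝ) 1) (hb : b ∈ Icc (0 : ℝ) 1) :
    a * b ∈ Icc (0 : ℝ) 1 := ⟨mul_nonneg ha.1 hb.1, mul_le_one₀ ha.2 hb.1 hb.2⟩

theorem integrable_triangle {f g h : Ω × Ω → ℝ} (hf : Measurable f) (hg : Measurable g)
    (hh : Measurable h) (hf01 : ∀ p, f p ∈ Icc (0 : ℝ) 1) (hg01 : ∀ p, g p ∈ Icc (0 : ℝ) 1)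
    (hh01 : ∀ p, h p ∈ Icc (0 : ℝ) 1) :
    Integrable (fun t : Ω × Ω × Ω => f t.2 * g (t.2.2, t.1) * h (t.1, t.2.1))
      (μ.prod (μ.prod μ)) :=
  integrable_of_mem_Icc
    (((hf.comp measurable_edge₁).mul (hg.comp measurable_edge₂)).mul (hh.comp measurable_edge₃))
    fun _ => mul_mem_Icc_zero_one (mul_mem_Icc_zero_one (hf01 _) (hg01 _)) (hh01 _)

/-- For fixed `z` the other two factors are a weight in `x` times a weight in `y`, so the inner
integral is bounded by the cut norm. -/
theorem abs_triangleDensity_sub_le_left {f f' g h : Ω × Ω → ℝ} (hf : Measurable f)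
    (hf' : Measurable f') (hg : Measurable g) (hh : Measurable h)
    (hf01 : ∀ p, f p ∈ Icc (0 : ℝ) 1) (hf'01 : ∀ p, f' p ∈ Icc (0 : ℝ) 1)
    (hg01 : ∀ p, g p ∈ Icc (0 : ℝ) 1) (hh01 : ∀ p, h p ∈ Icc (0 : ℝ) 1) :
    |triangleDensity μ f g h - triangleDensity μ f' g h| ≤ cutNorm μ fun p => f p - f' p := by
  have i1 := integrable_triangle (μ := μ) hf hg hh hf01 hg01 hh01
  have i2 := integrable_triangle (μ := μ) hf' hg hh hf'01 hg01 hh01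
  have hD : Integrable (fun p => f p - f' p) (μ.prod μ) :=
    (integrable_of_mem_Icc hf hf01).sub (integrable_of_mem_Icc hf' hf'01)
  have i3 : Integrable (fun t : Ω × Ω × Ω => f t.2 * g (t.2.2, t.1) * h (t.1, t.2.1) -
      f' t.2 * g (t.2.2, t.1) * h (t.1, t.2.1)) (μ.prod (μ.prod μ)) := i1.sub i2
  rw [triangleDensity, triangleDensity, ← integral_sub i1 i2, integral_prod _ i3]
  have key : ∀ z, ‖∫ p : Ω × Ω, (f p * g (p.2, z) * h (z, p.1) - f' p * g (p.2, z) * h (z, p.1))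
      ∂(μ.prod μ)‖ ≤ cutNorm μ fun p => f p - f' p := by
    intro z
    have := abs_integral_mul_mul_le_cutNorm hD (f := fun x => h (z, x)) (g := fun y => g (y, z))
      (hh.comp measurable_prodMk_left) (fun x => hh01 _)
      (hg.comp measurable_prodMk_right) (fun y => hg01 _)
    rw [Real.norm_eq_abs]
    convert this using 3
    ext p
    ring
  have := norm_integral_le_of_norm_le_const (μ := μ) (Eventually.of_forall key)
  simpa using this

theorem abs_triangleDensity_sub_le {f f' g g' h h' : Ω × Ω → ℝ} (hf : Measurable f)
    (hf' : Measurable f') (hg : Measurable g) (hg' : Measurable g') (hh : Measurable h)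
    (hh' : Measurable h') (hf01 : ∀ p, f p ∈ Icc (0 : ℝ) 1) (hf'01 : ∀ p, f' p ∈ Icc (0 : ℝ) 1)
    (hg01 : ∀ p, g p ∈ Icc (0 : ℝ) 1) (hg'01 : ∀ p, g' p ∈ Icc (0 : ℝ) 1)
    (hh01 : ∀ p, h p ∈ Icc (0 : ℝ) 1) (hh'01 : ∀ p, h' p ∈ Icc (0 : ℝ) 1) :
    |triangleDensity μ f g h - triangleDensity μ f' g' h'| ≤
      cutNorm μ (fun p => f p - f' p) + cutNorm μ (fun p => g p - g' p) +
        cutNorm μ (fun p => h p - h' p) := by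
  have h1 := abs_triangleDensity_sub_le_left (μ := μ) hf hf' hg hh hf01 hf'01 hg01 hh01
  have h2 := abs_triangleDensity_sub_le_left (μ := μ) hg hg' hh hf' hg01 hg'01 hh01 hf'01
  have h3 := abs_triangleDensity_sub_le_left (μ := μ) hh hh' hf' hg' hh01 hh'01 hf'01 hg'01
  -- The factors are replaced one at a time; rotation undoes the shift that brought the replaced
  -- factor to the front.
  rw [← triangleDensity_rotate μ hf' hg hh, ← triangleDensity_rotate μ hf' hg' hh] at h2
  rw [triangleDensity_rotate μ hh hf' hg', triangleDensity_rotate μ hh' hf' hg'] at h3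
  have := abs_sub_le (triangleDensity μ f g h) (triangleDensity μ f' g h)
    (triangleDensity μ f' g' h')
  have := abs_sub_le (triangleDensity μ f' g h) (triangleDensity μ f' g' h)
    (triangleDensity μ f' g' h')
  linarith

theorem ae_eq_zero_of_triangleDensity_eq_zero {f g h : Ω × Ω → ℝ} (hf : Measurable f)
    (hg : Measurable g) (hh : Measurable h) (hf01 : ∀ p, f p ∈ Icc (0 : ℝ) 1)
    (hg01 : ∀ p, g p ∈ Icc (0 : ℝ) 1) (hh01 : ∀ p, h p ∈ Icc (0 : ℝ) 1)
    (h0 : triangleDensity μ f g h = 0) :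
    ∀ᵐ t : Ω × Ω × Ω ∂(μ.prod (μ.prod μ)), f t.2 * g (t.2.2, t.1) * h (t.1, t.2.1) = 0 :=
  (integral_eq_zero_iff_of_nonneg
    (fun _ => mul_nonneg (mul_nonneg (hf01 _).1 (hg01 _).1) (hh01 _).1)
    (integrable_triangle hf hg hh hf01 hg01 hh01)).1 h0

end CycleDensity

/-! ### Box densities and their convergence. -/

section CellDensity

open Filter Topology

variable {Ω : Type u} [MeasurableSpace Ω] (μ : Measure Ω)

/-- If almost every triangle has an edge in the corresponding one of the sets `P`, `Q`, `R`, then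
these sets together cover each box. -/
theorem mul_mul_le_of_ae_triangle [IsProbabilityMeasure μ] {P Q R : Set (Ω × Ω)}
    (hQ : MeasurableSet Q) (hR : MeasurableSet R)
    (h : ∀ᵐ t : Ω × Ω × Ω ∂(μ.prod (μ.prod μ)),
      t.2 ∈ P ∨ (t.2.2, t.1) ∈ Q ∨ (t.1, t.2.1) ∈ R)
    {a b c : Set Ω} (ha : MeasurableSet a) (hb : MeasurableSet b) (hc : MeasurableSet c) :
    μ.real a * μ.real b * μ.real c ≤ (μ.prod μ).real (P ∩ a ×ˢ b) * μ.real c +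
      (μ.prod μ).real (Q ∩ b ×ˢ c) * μ.real a + (μ.prod μ).real (R ∩ c ×ˢ a) * μ.real b := by
  have hrot := measurePreserving_tripleRotation μ
  set μ₃ := μ.prod (μ.prod μ) with hμ₃
  set P' : Set (Ω × Ω × Ω) := c ×ˢ (P ∩ a ×ˢ b)
  set Q' : Set (Ω × Ω × Ω) := a ×ˢ (Q ∩ b ×ˢ c)
  set R' : Set (Ω × Ω × Ω) := b ×ˢ (R ∩ c ×ˢ a)
  have hQ' : MeasurableSet Q' := ha.prod (hQ.inter (hb.prod hc))
  have hR' : MeasurableSet R' := hb.prod (hR.inter (hc.prod ha))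
  -- Rotations bring the edge tested by `Q` or `R` into the last two coordinates, where it splits
  -- off as a factor.
  have hsub : μ₃ (c ×ˢ a ×ˢ b) ≤
      μ₃ (P' ∪ (tripleRotation ⁻¹' Q' ∪ tripleRotation ⁻¹' (tripleRotation ⁻¹' R'))) := by
    refine measure_mono_ae ?_
    filter_upwards [h] with t ht hbox
    obtain ⟨htc, hta, htb⟩ := hbox
    rcases ht with h | h | h
    · exact Or.inl ⟨htc, h, hta, htb⟩
    · exact Or.inr (Or.inl ⟨hta, h, htb, htc⟩)
    · exact Or.inr (Or.inr ⟨htb, h, htc, hta⟩)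
  have h1 : μ₃.real (c ×ˢ a ×ˢ b) ≤ μ₃.real P' + μ₃.real Q' + μ₃.real R' := by
    refine (ENNReal.toReal_mono (measure_ne_top _ _) hsub).trans ?_
    refine (measureReal_union_le _ _).trans ?_
    rw [add_assoc]
    refine add_le_add le_rfl ((measureReal_union_le _ _).trans (le_of_eq ?_))
    rw [hrot.measureReal_preimage hQ'.nullMeasurableSet,
      hrot.measureReal_preimage (hrot.measurable hR').nullMeasurableSet,
      hrot.measureReal_preimage hR'.nullMeasurableSet]
  simp only [hμ₃, P', Q', R', measureReal_prod_prod] at h1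
  linarith

/-- The density of `A` in the box containing `p` of the partition of the square into boxes given
by `f`. -/
noncomputable def cellDensity {ι : Type*} (f : Ω → ι) (A : Set (Ω × Ω)) (p : Ω × Ω) : ℝ :=
  (μ.prod μ).real (A ∩ (f ⁻¹' {f p.1}) ×ˢ (f ⁻¹' {f p.2})) /
    (μ.real (f ⁻¹' {f p.1}) * μ.real (f ⁻¹' {f p.2}))

theorem measurable_cellDensity {ι : Type*} [MeasurableSpace ι] [DiscreteMeasurableSpace ι]
    [Countable ι] {f : Ω → ι} (hf : Measurable f) (A : Set (Ω × Ω)) :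
    Measurable (cellDensity μ f A) :=
  measurable_comp_fin_prod hf fun i j => (μ.prod μ).real (A ∩ (f ⁻¹' {i}) ×ˢ (f ⁻¹' {j})) /
    (μ.real (f ⁻¹' {i}) * μ.real (f ⁻¹' {j}))

theorem cellDensity_nonneg {ι : Type*} (f : Ω → ι) (A : Set (Ω × Ω)) (p : Ω × Ω) :
    0 ≤ cellDensity μ f A p := by
  unfold cellDensity
  positivity

variable [IsProbabilityMeasure μ]

theorem cellDensity_mono {ι : Type*} (f : Ω → ι) {A B : Set (Ω × Ω)} (h : A ⊆ B) (p : Ω × Ω) :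
    cellDensity μ f A p ≤ cellDensity μ f B p := by
  unfold cellDensity
  gcongr
  exact measure_ne_top _ _

theorem measureReal_inter_box_le (A : Set (Ω × Ω)) (a b : Set Ω) :
    (μ.prod μ).real (A ∩ a ×ˢ b) ≤ μ.real a * μ.real b := by
  rw [← measureReal_prod_prod]
  exact measureReal_mono inter_subset_right

theorem cellDensity_le_one {ι : Type*} (f : Ω → ι) (A : Set (Ω × Ω)) (p : Ω × Ω) :
    cellDensity μ f A p ≤ 1 :=
  div_le_one_of_le₀ (measureReal_inter_box_le μ _ _ _) (by positivity)

theorem measureReal_compl_inter_box {A : Set (Ω × Ω)} (hA : MeasurableSet A) (a b : Set Ω) :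
    (μ.prod μ).real (Aᶜ ∩ a ×ˢ b) = μ.real a * μ.real b - (μ.prod μ).real (A ∩ a ×ˢ b) := by
  have := measureReal_inter_add_sdiff (μ := μ.prod μ) (s := a ×ˢ b) hA
  rw [sdiff_eq] at this
  rw [← measureReal_prod_prod, inter_comm, inter_comm A]
  linarith

/-- Averaging over the boxes approximates an indicator in `L¹` as well as any step function, up to
a factor `2`. -/
theorem integral_abs_indicator_sub_cellDensity_le {ι : Type*} [MeasurableSpace ι]
    [DiscreteMeasurableSpace ι] [Fintype ι] {f : Ω → ι} (hf : Measurable f)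
    {A : Set (Ω × Ω)} (hA : MeasurableSet A) (U : ι → ι → ℝ) :
    ∫ p, |A.indicator 1 p - cellDensity μ f A p| ∂(μ.prod μ) ≤
      2 * ∫ p, |A.indicator 1 p - U (f p.1) (f p.2)| ∂(μ.prod μ) := by
  have hAi : Integrable (A.indicator (1 : Ω × Ω → ℝ)) (μ.prod μ) :=
    (integrable_const (1 : ℝ)).indicator hA
  have hUi : Integrable (fun p : Ω × Ω => U (f p.1) (f p.2)) (μ.prod μ) :=
    integrable_comp_fin_prod hf U
  have hdi : Integrable (cellDensity μ f A) (μ.prod μ) :=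
    integrable_of_mem_Icc (measurable_cellDensity μ hf A)
      fun p => ⟨cellDensity_nonneg μ f A p, cellDensity_le_one μ f A p⟩
  have i1 : Integrable (fun p => |A.indicator 1 p - U (f p.1) (f p.2)|) (μ.prod μ) :=
    (hAi.sub hUi).abs
  have i2 : Integrable (fun p => |U (f p.1) (f p.2) - cellDensity μ f A p|) (μ.prod μ) :=
    (hUi.sub hdi).abs
  let C : ι × ι → Set (Ω × Ω) := fun z => (f ⁻¹' {z.1}) ×ˢ (f ⁻¹' {z.2})
  have hC : ∀ z, MeasurableSet (C z) := fun z =>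
    (hf (measurableSet_singleton _)).prod (hf (measurableSet_singleton _))
  have hCd : Pairwise (Function.onFun Disjoint C) := by
    intro z z' hz
    refine Set.disjoint_left.2 fun p hp hp' => hz ?_
    simp only [C, mem_prod, mem_preimage, mem_singleton_iff] at hp hp'
    exact Prod.ext (hp.1.symm.trans hp'.1) (hp.2.symm.trans hp'.2)
  have hCu : ⋃ z, C z = univ := by
    ext p
    simp [C]
  have hsplit : ∀ G : Ω × Ω → ℝ, Integrable G (μ.prod μ) →
      ∫ p, G p ∂(μ.prod μ) = ∑ z, ∫ p in C z, G p ∂(μ.prod μ) := by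
    intro G hG
    rw [← setIntegral_univ, ← hCu, integral_iUnion_fintype hC hCd fun _ => hG.integrableOn]
  -- Averaging over a cell contracts `L¹` and fixes the step function, hence the factor 2 by the
  -- triangle inequality.
  have key : ∫ p, |U (f p.1) (f p.2) - cellDensity μ f A p| ∂(μ.prod μ) ≤
      ∫ p, |A.indicator 1 p - U (f p.1) (f p.2)| ∂(μ.prod μ) := by
    rw [hsplit _ i2, hsplit _ i1]
    refine Finset.sum_le_sum fun z _ => ?_
    set u := U z.1 z.2 with hu
    set m := μ.real (f ⁻¹' {z.1}) * μ.real (f ⁻¹' {z.2}) with hm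
    have hmC : (μ.prod μ).real (C z) = m := measureReal_prod_prod _ _
    have hCeq : ∀ p ∈ C z, f p.1 = z.1 ∧ f p.2 = z.2 := fun p hp => hp
    have e1 : ∫ p in C z, |U (f p.1) (f p.2) - cellDensity μ f A p| ∂(μ.prod μ)
        = |u * m - (μ.prod μ).real (A ∩ C z)| := by
      have : ∀ p ∈ C z, |U (f p.1) (f p.2) - cellDensity μ f A p|
          = |u - (μ.prod μ).real (A ∩ C z) / m| := by
        intro p hp
        simp only [cellDensity, (hCeq p hp).1, (hCeq p hp).2, hu, hm, C]
      rw [setIntegral_congr_fun (hC z) this, setIntegral_const, smul_eq_mul, hmC]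
      have hm0 : 0 ≤ m := by positivity
      rcases hm0.eq_or_lt with h0 | h0
      · have : (μ.prod μ).real (A ∩ C z) = 0 :=
          le_antisymm ((measureReal_inter_box_le μ _ _ _).trans h0.symm.le) measureReal_nonneg
        simp [← h0, this]
      · rw [← abs_of_pos h0, ← abs_mul, abs_of_pos h0]
        congr 1
        field_simp
    have e2 : u * m - (μ.prod μ).real (A ∩ C z)
        = ∫ p in C z, (u - A.indicator 1 p) ∂(μ.prod μ) := by
      rw [integral_sub (integrable_const _) hAi.integrableOn, setIntegral_const, smul_eq_mul, hmC,
        integral_indicator_one hA, measureReal_restrict_apply hA, mul_comm]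
    rw [e1, e2]
    refine abs_integral_le_integral_abs.trans (le_of_eq ?_)
    refine setIntegral_congr_fun (hC z) fun p hp => ?_
    simp only [(hCeq p hp).1, (hCeq p hp).2, hu]
    exact abs_sub_comm _ _
  calc ∫ p, |A.indicator 1 p - cellDensity μ f A p| ∂(μ.prod μ)
      ≤ ∫ p, (|A.indicator 1 p - U (f p.1) (f p.2)| +
          |U (f p.1) (f p.2) - cellDensity μ f A p|) ∂(μ.prod μ) :=
        integral_mono (hAi.sub hdi).abs (i1.add i2) fun p => abs_sub_le _ _ _
    _ ≤ _ := by
        rw [integral_add i1 i2]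
        linarith

/-- By Tonelli the series of the `|G - d n|` has finite integral, so it converges almost everywhere
and its terms tend to 0. -/
theorem ae_tendsto_of_summable_integral_abs {Z : Type*} [MeasurableSpace Z] {P : Measure Z}
    {G : Z → ℝ} {d : ℕ → Z → ℝ} (hG : Integrable G P) (hd : ∀ n, Integrable (d n) P) {ε : ℕ → ℝ}
    (hε : Summable ε) (h : ∀ n, ∫ z, |G z - d n z| ∂P ≤ ε n) :
    ∀ᵐ z ∂P, Tendsto (fun n => d n z) atTop (𝓝 (G z)) := by
  have hε0 : ∀ n, 0 ≤ ε n := fun n => (integral_nonneg fun _ => abs_nonneg _).trans (h n)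
  have hi : ∀ n, Integrable (fun z => G z - d n z) P := fun n => hG.sub (hd n)
  have hfin : ∫⁻ z, ∑' n, ‖G z - d n z‖ₑ ∂P ≠ ⊤ := by
    rw [lintegral_tsum fun n => (hi n).aestronglyMeasurable.enorm]
    refine ne_top_of_le_ne_top hε.tsum_ofReal_ne_top (ENNReal.tsum_le_tsum fun n => ?_)
    have := ofReal_integral_norm_eq_lintegral_enorm (hi n)
    rw [← this]
    exact ENNReal.ofReal_le_ofReal (h n)
  filter_upwards [ae_lt_top' (AEMeasurable.tsum fun n => (hi n).aestronglyMeasurable.enorm) hfin]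
    with z hz
  have h1 := ENNReal.tendsto_atTop_zero_of_tsum_ne_top hz.ne
  rw [tendsto_iff_norm_sub_tendsto_zero]
  have h2 := (ENNReal.tendsto_toReal ENNReal.zero_ne_top).comp h1
  refine h2.congr fun n => ?_
  simp [norm_sub_rev]

/-- Two functions on the square admit good step approximations over the same partition. -/
theorem exists_common_step {G H : Ω × Ω → ℝ} (hG : Integrable G (μ.prod μ))
    (hH : Integrable H (μ.prod μ)) {ε : ℝ} (hε : 0 < ε) :
    ∃ (n : ℕ) (f : Ω → Fin n) (U U' : Fin n → Fin n → ℝ), Measurable f ∧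
      ∫ p, |G p - U (f p.1) (f p.2)| ∂(μ.prod μ) ≤ ε ∧
      ∫ p, |H p - U' (f p.1) (f p.2)| ∂(μ.prod μ) ≤ ε := by
  obtain ⟨n, _, ⟨f, hf, U, rfl⟩, h⟩ := hG.exists_isStep_integral_abs_sub_le hε
  obtain ⟨m, _, ⟨g, hg, U', rfl⟩, h'⟩ := hH.exists_isStep_integral_abs_sub_le hε
  refine ⟨n * m, fun x => finProdFinEquiv (f x, g x),
    fun i j => U (finProdFinEquiv.symm i).1 (finProdFinEquiv.symm j).1,
    fun i j => U' (finProdFinEquiv.symm i).2 (finProdFinEquiv.symm j).2,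
    (measurable_of_finite _).comp (hf.prodMk hg), ?_, ?_⟩
  · simpa only [Equiv.symm_apply_apply] using h
  · simpa only [Equiv.symm_apply_apply] using h'

end CellDensity

/-! ### Repairing almost-everywhere poset kernels. -/

section PosetKernel

open Filter Topology

variable {Ω : Type u} [MeasurableSpace Ω] {μ : Measure Ω} {ι : Type*}

/-- Division by zero gives null cells density 0. -/
theorem measureReal_fiber_pos_of_cellDensity_pos {f : Ω → ι} {A : Set (Ω × Ω)}
    {p : Ω × Ω} (h : 0 < cellDensity μ f A p) :
    0 < μ.real (f ⁻¹' {f p.1}) ∧ 0 < μ.real (f ⁻¹' {f p.2}) := by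
  constructor <;>
  · refine measureReal_nonneg.lt_of_ne fun h0 => h.ne' ?_
    simp [cellDensity, ← h0]

theorem measureReal_inter_box_eq_cellDensity_mul {f : Ω → ι} (A : Set (Ω × Ω))
    {x y : Ω} (hx : 0 < μ.real (f ⁻¹' {f x})) (hy : 0 < μ.real (f ⁻¹' {f y})) :
    (μ.prod μ).real (A ∩ (f ⁻¹' {f x}) ×ˢ (f ⁻¹' {f y})) =
      cellDensity μ f A (x, y) * (μ.real (f ⁻¹' {f x}) * μ.real (f ⁻¹' {f y})) := by
  simp only [cellDensity]
  field_simp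

variable [IsProbabilityMeasure μ]

/-- Along suitable partitions, the cell densities of two given sets converge almost everywhere to
their indicators. -/
theorem exists_tendsto_cellDensity {A B : Set (Ω × Ω)} (hA : MeasurableSet A)
    (hB : MeasurableSet B) :
    ∃ (m : ℕ → ℕ) (f : ∀ n, Ω → Fin (m n)), (∀ n, Measurable (f n)) ∧
      (∀ᵐ p ∂(μ.prod μ), Tendsto (fun n => cellDensity μ (f n) A p) atTop
        (𝓝 (A.indicator 1 p))) ∧
      ∀ᵐ p ∂(μ.prod μ), Tendsto (fun n => cellDensity μ (f n) B p) atTop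
        (𝓝 (B.indicator 1 p)) := by
  have hi : ∀ A : Set (Ω × Ω), MeasurableSet A →
      Integrable (A.indicator (1 : Ω × Ω → ℝ)) (μ.prod μ) :=
    fun A hA => (integrable_const (1 : ℝ)).indicator hA
  -- Summable errors give almost everywhere convergence without nested partitions or martingales.
  choose m f U U' hf hU hU' using fun n : ℕ => exists_common_step μ (hi A hA) (hi B hB)
    (show (0 : ℝ) < (1 / 2) ^ n by positivity)
  have hs : Summable fun n : ℕ => 2 * (1 / 2 : ℝ) ^ n :=
    (summable_geometric_of_lt_one (by norm_num) (by norm_num)).mul_left 2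
  have hd : ∀ A n, Integrable (cellDensity μ (f n) A) (μ.prod μ) := fun A n =>
    integrable_of_mem_Icc (measurable_cellDensity μ (hf n) A)
      fun p => ⟨cellDensity_nonneg μ _ A p, cellDensity_le_one μ _ A p⟩
  refine ⟨m, f, hf, ?_, ?_⟩
  · refine ae_tendsto_of_summable_integral_abs (hi A hA) (hd A) hs fun n => ?_
    exact (integral_abs_indicator_sub_cellDensity_le μ (hf n) hA (U n)).trans
      (mul_le_mul_of_nonneg_left (hU n) zero_le_two)
  · refine ae_tendsto_of_summable_integral_abs (hi B hB) (hd B) hs fun n => ?_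
    exact (integral_abs_indicator_sub_cellDensity_le μ (hf n) hB (U' n)).trans
      (mul_le_mul_of_nonneg_left (hU' n) zero_le_two)

variable [MeasurableSpace ι] [DiscreteMeasurableSpace ι]

/-- A set that is almost everywhere transitive into `B` has cell densities that satisfy a
transitivity inequality. -/
theorem cellDensity_trans {f : Ω → ι} (hf : Measurable f) {A B : Set (Ω × Ω)}
    (hA : MeasurableSet A) (hB : MeasurableSet B)
    (h : ∀ᵐ t : Ω × Ω × Ω ∂(μ.prod (μ.prod μ)),
      t.2 ∈ A → (t.2.2, t.1) ∈ A → (t.2.1, t.1) ∈ B) {x y z : Ω}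
    (hxy : 0 < cellDensity μ f A (x, y)) (hyz : 0 < cellDensity μ f A (y, z)) :
    cellDensity μ f A (x, y) + cellDensity μ f A (y, z) - 1 ≤ cellDensity μ f B (x, z) := by
  obtain ⟨hx, hy⟩ := measureReal_fiber_pos_of_cellDensity_pos hxy
  obtain ⟨-, hz⟩ := measureReal_fiber_pos_of_cellDensity_pos hyz
  simp only at hx hy hz
  have hm : ∀ x, MeasurableSet (f ⁻¹' {f x}) := fun x => hf (measurableSet_singleton _)
  -- Divided by the cell measures, this reads `1 ≤ (1 - d_xy) + (1 - d_yz) + d_xz`.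
  have key := mul_mul_le_of_ae_triangle μ (P := Aᶜ) (Q := Aᶜ) (R := Prod.swap ⁻¹' B) hA.compl
    (measurable_swap hB) (by
      filter_upwards [h] with t ht
      by_contra! hc
      simp only [mem_compl_iff, not_not] at hc
      exact hc.2.2 (ht hc.1 hc.2.1)) (hm x) (hm y) (hm z)
  have hswap : (μ.prod μ).real (Prod.swap ⁻¹' B ∩ (f ⁻¹' {f z}) ×ˢ (f ⁻¹' {f x}))
      = (μ.prod μ).real (B ∩ (f ⁻¹' {f x}) ×ˢ (f ⁻¹' {f z})) := by
    rw [← (Measure.measurePreserving_swap (μ := μ) (ν := μ)).measureReal_preimage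
      (hB.inter ((hm x).prod (hm z))).nullMeasurableSet, preimage_inter, preimage_swap_prod]
  rw [hswap, measureReal_compl_inter_box μ hA, measureReal_compl_inter_box μ hA,
    measureReal_inter_box_eq_cellDensity_mul A hx hy,
    measureReal_inter_box_eq_cellDensity_mul A hy hz,
    measureReal_inter_box_eq_cellDensity_mul B hx hz] at key
  have hpos : 0 < μ.real (f ⁻¹' {f x}) * μ.real (f ⁻¹' {f y}) * μ.real (f ⁻¹' {f z}) := by
    positivity
  refine le_of_mul_le_mul_right ?_ hpos
  linarith

/-- A set with almost no directed triangles has small cell densities on the diagonal. -/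
theorem cellDensity_diag_le {f : Ω → ι} (hf : Measurable f) {A : Set (Ω × Ω)}
    (hA : MeasurableSet A)
    (h : ∀ᵐ t : Ω × Ω × Ω ∂(μ.prod (μ.prod μ)),
      ¬ (t.2 ∈ A ∧ (t.2.2, t.1) ∈ A ∧ (t.1, t.2.1) ∈ A)) (x : Ω) :
    cellDensity μ f A (x, x) ≤ 2 / 3 := by
  rcases (cellDensity_nonneg μ f A (x, x)).eq_or_lt with h0 | h0
  · rw [← h0]
    norm_num
  obtain ⟨hx, -⟩ := measureReal_fiber_pos_of_cellDensity_pos h0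
  simp only at hx
  have hm : MeasurableSet (f ⁻¹' {f x}) := hf (measurableSet_singleton _)
  -- Divided by the cube of the cell measure, this reads `1 ≤ 3 * (1 - d)`.
  have key := mul_mul_le_of_ae_triangle μ (P := Aᶜ) (Q := Aᶜ) (R := Aᶜ) hA.compl hA.compl (by
      filter_upwards [h] with t ht
      simp only [mem_compl_iff]
      tauto) hm hm hm
  rw [measureReal_compl_inter_box μ hA, measureReal_inter_box_eq_cellDensity_mul A hx hx] at key
  have hpos : 0 < μ.real (f ⁻¹' {f x}) * μ.real (f ⁻¹' {f x}) * μ.real (f ⁻¹' {f x}) := by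
    positivity
  refine le_of_mul_le_mul_right ?_ hpos
  linarith

/-- A kernel that satisfies the axioms of a poset kernel almost everywhere is almost everywhere
equal to a poset kernel. -/
theorem exists_isPosetKernel_ae_eq (K : CutFunction.{u})
    (htrans : ∀ᵐ t ∂(K.μ.prod (K.μ.prod K.μ)),
      0 < K.W t.2 → 0 < K.W (t.2.2, t.1) → K.W (t.2.1, t.1) = 1)
    (hirrefl : ∀ᵐ t ∂(K.μ.prod (K.μ.prod K.μ)),
      ¬ (0 < K.W t.2 ∧ 0 < K.W (t.2.2, t.1) ∧ 0 < K.W (t.1, t.2.1))) :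
    ∃ K' : CutFunction.{u}, K'.IsPosetKernel ∧ K.CutEquiv K' := by
  classical
  set A : Set (K.carrier × K.carrier) := {p | 0 < K.W p} with hAdef
  set B : Set (K.carrier × K.carrier) := {p | K.W p = 1} with hBdef
  have hA : MeasurableSet A := measurableSet_lt measurable_const K.measurable_W
  have hB : MeasurableSet B := K.measurable_W (measurableSet_singleton 1)
  have hBA : B ⊆ A := fun p hp => by
    rw [hAdef, mem_ofPred_eq, show K.W p = 1 from hp]
    exact one_pos
  obtain ⟨m, f, hf, hfA, hfB⟩ := exists_tendsto_cellDensity (μ := K.μ) hA hB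
  -- `D A` collects the points where the box densities of `A` tend to 1. It agrees with `A` almost
  -- everywhere for the two sets at hand, yet is governed by inequalities valid at every point.
  let D : Set (K.carrier × K.carrier) → Set (K.carrier × K.carrier) := fun A =>
    {p | Tendsto (fun n => cellDensity K.μ (f n) A p) atTop (𝓝 1)}
  have hD : ∀ A, MeasurableSet (D A) := fun A =>
    measurableSet_tendsto (𝓝 1) fun n => measurable_cellDensity K.μ (hf n) A
  have hDBA : D B ⊆ D A := fun p hp =>
    tendsto_of_tendsto_of_tendsto_of_le_of_le hp tendsto_const_nhds
      (fun n => cellDensity_mono K.μ _ hBA p) fun n => cellDensity_le_one K.μ _ A p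
  -- The lower bound from `cellDensity_trans` tends to `1 + 1 - 1`.
  have hDtrans : ∀ x y z, (x, y) ∈ D A → (y, z) ∈ D A → (x, z) ∈ D B := by
    intro x y z hxy hyz
    have h1 : Tendsto (fun n => cellDensity K.μ (f n) A (x, y) + cellDensity K.μ (f n) A (y, z) - 1)
        atTop (𝓝 1) := by
      simpa using (Tendsto.add hxy hyz).sub_const 1
    refine tendsto_of_tendsto_of_tendsto_of_le_of_le' h1 tendsto_const_nhds ?_
      (Eventually.of_forall fun n => cellDensity_le_one K.μ _ B _)
    filter_upwards [Tendsto.eventually_const_lt one_pos hxy,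
      Tendsto.eventually_const_lt one_pos hyz] with n h1 h2
    exact cellDensity_trans (hf n) hA hB htrans h1 h2
  have hDirrefl : ∀ x, (x, x) ∉ D A := fun x hx => by
    have := le_of_tendsto' hx fun n => cellDensity_diag_le (hf n) hA hirrefl x
    norm_num at this
  have hDA : ∀ᵐ p ∂(K.μ.prod K.μ), p ∈ D A ↔ p ∈ A := by
    filter_upwards [hfA] with p hp
    by_cases h : p ∈ A
    · simpa [D, h] using hp
    · simp only [h, not_false_eq_true, indicator_of_notMem] at hp
      simp only [h, iff_false]
      exact fun h' => zero_ne_one (tendsto_nhds_unique hp h')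
  have hDB : ∀ᵐ p ∂(K.μ.prod K.μ), p ∈ D B ↔ p ∈ B := by
    filter_upwards [hfB] with p hp
    by_cases h : p ∈ B
    · simpa [D, h] using hp
    · simp only [h, not_false_eq_true, indicator_of_notMem] at hp
      simp only [h, iff_false]
      exact fun h' => zero_ne_one (tendsto_nhds_unique hp h')
  let K' : CutFunction.{u} :=
    { carrier := K.carrier
      μ := K.μ
      W := fun p => if p ∈ D B then 1 else if p ∈ D A then K.W p else 0
      measurable_W := Measurable.ite (hD B) measurable_const
        (Measurable.ite (hD A) K.measurable_W measurable_const)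
      W_mem := fun p => by
        split_ifs
        · exact ⟨zero_le_one, le_rfl⟩
        · exact K.W_mem p
        · exact ⟨le_rfl, zero_le_one⟩ }
  have hK'pos : ∀ x y, 0 < K'.W (x, y) → (x, y) ∈ D A := by
    intro x y h
    by_contra hc
    simp [K', hc, mt (@hDBA (x, y)) hc] at h
  refine ⟨K', ⟨fun x y => (x, y) ∈ D A,
    { irrefl := hDirrefl
      trans := fun x y z hxy hyz => hDBA (hDtrans x y z hxy hyz) }, hD A, hK'pos,
    fun x y z hxy hyz => if_pos (hDtrans x y z (hK'pos _ _ hxy) (hK'pos _ _ hyz))⟩, ?_⟩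
  refine le_antisymm ?_ (CutFunction.cutDist_nonneg _ _)
  refine (CutFunction.cutDist_le (K₂ := K') K.μ (MeasurePreserving.id _)
    (MeasurePreserving.id _)).trans ?_
  have : (fun p : K.carrier × K.carrier => K.W (id p.1, id p.2) - K'.W (id p.1, id p.2))
      =ᵐ[K.μ.prod K.μ] fun _ => 0 := by
    filter_upwards [hDA, hDB] with p h1 h2
    simp only [id, Prod.mk.eta, K', h1, h2]
    split_ifs with h3 h4
    · rw [show K.W p = 1 from h3, sub_self]
    · exact sub_self _
    · rw [sub_zero]
      exact le_antisymm (not_lt.1 h4) (K.W_mem p).1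
  rw [cutNorm_congr_ae this]
  exact cutNorm_le fun S T _ _ => by simp

end PosetKernel

/-! ### The two triangle functionals and closedness. -/

namespace CutFunction

/-- The density of directed triangles. -/
noncomputable def cycleDensity (K : CutFunction.{u}) : ℝ := triangleDensity K.μ K.W K.W K.W

/-- The density of failures of transitivity. -/
noncomputable def intransitivity (K : CutFunction.{u}) : ℝ :=
  triangleDensity K.μ K.W K.W fun p => 1 - K.W p.swap

theorem measurable_one_sub_swap (K : CutFunction.{u}) :
    Measurable fun p : K.carrier × K.carrier => 1 - K.W p.swap :=
  measurable_const.sub (K.measurable_W.comp measurable_swap)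

theorem one_sub_swap_mem (K : CutFunction.{u}) (p : K.carrier × K.carrier) :
    1 - K.W p.swap ∈ Icc (0 : ℝ) 1 :=
  ⟨sub_nonneg.2 (K.W_mem _).2, sub_le_self _ (K.W_mem _).1⟩

theorem abs_cycleDensity_sub_le (K₁ K₂ : CutFunction.{u}) :
    |K₁.cycleDensity - K₂.cycleDensity| ≤ 3 * cutDist K₁ K₂ := by
  suffices |K₁.cycleDensity - K₂.cycleDensity| / 3 ≤ cutDist K₁ K₂ by linarith
  refine le_of_forall_gt_imp_ge_of_dense fun c hc => ?_
  obtain ⟨Ω, _, μ, _, φ₁, φ₂, h₁, h₂, h⟩ := exists_cutNorm_lt hc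
  have m₁ := K₁.measurable_W.comp (h₁.measurable.prodMap h₁.measurable)
  have m₂ := K₂.measurable_W.comp (h₂.measurable.prodMap h₂.measurable)
  have key := abs_triangleDensity_sub_le (μ := μ) m₁ m₂ m₁ m₂ m₁ m₂ (fun _ => K₁.W_mem _)
    (fun _ => K₂.W_mem _) (fun _ => K₁.W_mem _) (fun _ => K₂.W_mem _) (fun _ => K₁.W_mem _)
    (fun _ => K₂.W_mem _)
  rw [cycleDensity, cycleDensity,
    ← triangleDensity_comp K₁.μ h₁ K₁.measurable_W K₁.measurable_W K₁.measurable_W,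
    ← triangleDensity_comp K₂.μ h₂ K₂.measurable_W K₂.measurable_W K₂.measurable_W]
  simp only [Function.comp_def, Prod.map] at key
  linarith

/-- The constant 3 counts the three factors of the triangle; the complemented, transposed factor is
covered since the cut norm is invariant under swap and sign. -/
theorem abs_intransitivity_sub_le (K₁ K₂ : CutFunction.{u}) :
    |K₁.intransitivity - K₂.intransitivity| ≤ 3 * cutDist K₁ K₂ := by
  suffices |K₁.intransitivity - K₂.intransitivity| / 3 ≤ cutDist K₁ K₂ by linarith
  refine le_of_forall_gt_imp_ge_of_dense fun c hc => ?_
  obtain ⟨Ω, _, μ, _, φ₁, φ₂, h₁, h₂, h⟩ := exists_cutNorm_lt hc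
  have m₁ := K₁.measurable_W.comp (h₁.measurable.prodMap h₁.measurable)
  have m₂ := K₂.measurable_W.comp (h₂.measurable.prodMap h₂.measurable)
  have key := abs_triangleDensity_sub_le (μ := μ) m₁ m₂ m₁ m₂
    (K₁.measurable_one_sub_swap.comp (h₁.measurable.prodMap h₁.measurable))
    (K₂.measurable_one_sub_swap.comp (h₂.measurable.prodMap h₂.measurable)) (fun _ => K₁.W_mem _)
    (fun _ => K₂.W_mem _) (fun _ => K₁.W_mem _) (fun _ => K₂.W_mem _)
    (fun _ => K₁.one_sub_swap_mem _) (fun _ => K₂.one_sub_swap_mem _)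
  have hs := cutNorm_swap (μ := μ) fun p => K₁.W (φ₁ p.1, φ₁ p.2) - K₂.W (φ₂ p.1, φ₂ p.2)
  rw [intransitivity, intransitivity,
    ← triangleDensity_comp K₁.μ h₁ K₁.measurable_W K₁.measurable_W K₁.measurable_one_sub_swap,
    ← triangleDensity_comp K₂.μ h₂ K₂.measurable_W K₂.measurable_W K₂.measurable_one_sub_swap]
  simp only [Function.comp_def, Prod.map, Prod.swap, sub_sub_sub_cancel_left] at key hs ⊢
  rw [cutNorm_sub_comm (fun p => K₂.W (φ₂ p.2, φ₂ p.1)), hs] at key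
  linarith

theorem IsPosetKernel.cycleDensity_eq_zero {K : CutFunction.{u}} (hK : K.IsPosetKernel) :
    K.cycleDensity = 0 := by
  obtain ⟨r, hr, -, hpos, -⟩ := hK
  refine integral_eq_zero_of_ae (Filter.Eventually.of_forall fun t => ?_)
  by_contra hc
  simp only [Pi.zero_apply, mul_eq_zero, not_or] at hc
  have h := fun x y (h : K.W (x, y) ≠ 0) => hpos x y ((K.W_mem _).1.lt_of_ne' h)
  exact hr.irrefl _ (hr.trans _ _ _ (hr.trans _ _ _ (h _ _ hc.1.1) (h _ _ hc.1.2)) (h _ _ hc.2))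

theorem IsPosetKernel.intransitivity_eq_zero {K : CutFunction.{u}} (hK : K.IsPosetKernel) :
    K.intransitivity = 0 := by
  obtain ⟨r, -, -, -, htrans⟩ := hK
  refine integral_eq_zero_of_ae (Filter.Eventually.of_forall fun t => ?_)
  by_contra hc
  simp only [Pi.zero_apply, mul_eq_zero, not_or] at hc
  have h := fun x y (h : K.W (x, y) ≠ 0) => (K.W_mem _).1.lt_of_ne' h
  exact hc.2 (sub_eq_zero.2 (htrans _ _ _ (h _ _ hc.1.1) (h _ _ hc.1.2)).symm)

end CutFunction

namespace CutSpace

open CutFunction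

/-- Both functionals vanish on poset kernels and are Lipschitz, so they vanish at a limit point.
Their integrands are nonnegative, hence zero almost everywhere, which is the input of
`exists_isPosetKernel_ae_eq`. -/
theorem isClosed_posetKernels : IsClosed posetKernels.{u} := by
  refine isClosed_of_closure_subset fun x hx => ?_
  rw [Metric.mem_closure_iff] at hx
  obtain ⟨K, rfl⟩ : ∃ K, mk K = x := ⟨_, mk_out x⟩
  have h1 : |K.cycleDensity| ≤ 0 ∧ |K.intransitivity| ≤ 0 := by
    constructor <;>
    · refine le_of_forall_pos_le_add fun ε hε => ?_
      obtain ⟨_, ⟨L, hL, rfl⟩, h⟩ := hx (ε / 3) (by positivity)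
      rw [dist_mk_mk] at h
      have h1 := abs_cycleDensity_sub_le K L
      have h2 := abs_intransitivity_sub_le K L
      rw [IsPosetKernel.cycleDensity_eq_zero hL, sub_zero] at h1
      rw [IsPosetKernel.intransitivity_eq_zero hL, sub_zero] at h2
      linarith
  have hc := ae_eq_zero_of_triangleDensity_eq_zero K.measurable_W K.measurable_W K.measurable_W
    K.W_mem K.W_mem K.W_mem (abs_nonpos_iff.1 h1.1)
  have ht := ae_eq_zero_of_triangleDensity_eq_zero K.measurable_W K.measurable_W
    K.measurable_one_sub_swap K.W_mem K.W_mem K.one_sub_swap_mem (abs_nonpos_iff.1 h1.2)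
  obtain ⟨K', hK', hKK'⟩ := exists_isPosetKernel_ae_eq K
    (by
      filter_upwards [ht] with t ht h1 h2
      have := (mul_eq_zero.1 ht).resolve_left (mul_pos h1 h2).ne'
      exact (sub_eq_zero.1 this).symm)
    (by
      filter_upwards [hc] with t ht h
      exact (mul_pos (mul_pos h.1 h.2.1) h.2.2).ne' ht)
  exact ⟨K', hK', (mk_eq_mk.2 hKK').symm⟩

end CutSpace

/-- Cut-equivalence is an equivalence relation, the cut metric is well defined on the quotient and
makes it a compact metric space, and the classes of poset kernels form a closed, hence compact,
subspace. -/
theorem theorem6p10 :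
    Equivalence CutFunction.CutEquiv.{u} ∧
    ∃ m : MetricSpace CutSpace.{u},
      (∀ K₁ K₂ : CutFunction.{u},
        dist (CutSpace.mk K₁) (CutSpace.mk K₂) = CutFunction.cutDist K₁ K₂) ∧
      CompactSpace CutSpace.{u} ∧
      IsClosed CutSpace.posetKernels.{u} ∧
      IsCompact CutSpace.posetKernels.{u} :=
  ⟨CutFunction.cutEquiv_equivalence, inferInstance, CutSpace.dist_mk_mk, inferInstance,
    CutSpace.isClosed_posetKernels, CutSpace.isClosed_posetKernels.isCompact⟩
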